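/- Let $h\in\mathbb{C}$ be such that $\mathfrak{q}:=e^h$ is not a root of unity, and let $U_{\mathfrak q}\mathfrak{sl}_2$ be the algebra with generators $E,F,K^{\pm1}$ and relations $KEK^{-1}=\mathfrak q^2E$, $KFK^{-1}=\mathfrak q^{-2}F$, $[E,F]=\frac{K-K^{-1}}{\mathfrak q-\mathfrak q^{-1}}$, $KK^{-1}=K^{-1}K=1$. Let $n\ge 0$, $\alpha_i,\zeta_i\in\mathbb{C}$ for $1\le i\le n$, and let $\mathcal X_i$ be irreducible $U_{\mathfrak q}\mathfrak{sl}_2$-modules with highest-weight vectors $|0_i\rangle\ne0$, $E|0_i\rangle=0$, $K|0_i\rangle=\mathfrak q^{\alpha_i-1}|0_i\rangle$. Put $\mathcal X=\bigotimes_{i=1}^n\mathcal X_i$ and $|\mathbf 0\rangle=\bigotimes_i|0_i\rangle$. Let $H$ act on $F^k|0_i\rangle$ by $\alpha_i-1-2k$, so that $K=\mathfrak q^{H}$, and put $K^{\pm1/2}:=\mathfrak q^{\pm H/2}$. Operators on $\mathbb{C}^2\otimes\mathcal X_i$ are written as $2\times2$ matrices with entries in $\mathrm{End}(\mathcal X_i)$.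 Let $$\mathsf R_{0,i}=\begin{pmatrix}K^{1/2}&2\sinh(h)K^{1/2}F\\0&K^{-1/2}\end{pmatrix},\qquad \mathsf R_{i,0}=\begin{pmatrix}K^{1/2}&0\\2\sinh(h)K^{-1/2}E&K^{-1/2}\end{pmatrix}$$ (the universal $R$-matrix evaluated on $\mathbb C^2\otimes\mathcal X_i$ and on $\mathcal X_i\otimes\mathbb C^2$) and $$R_{0,i}(u)=\tfrac12e^{u+h/2}\,\mathsf R_{0,i}-\tfrac12e^{-u-h/2}\,\mathsf R_{i,0}^{-1},\qquad R_{i,0}(u)=\tfrac12e^{u+h/2}\,\mathsf R_{i,0}-\tfrac12e^{-u-h/2}\,\mathsf R_{0,i}^{-1}.$$ Define $T(u)=R_{0,n}(u-\zeta_n)\cdots R_{0,1}(u-\zeta_1)$, $\hat T(u)=R_{1,0}(u+\zeta_1)\cdots R_{n,0}(u+\zeta_n)$, $$\begin{pmatrix}\mathcal A(u)&\mathcal B(u)\\\mathcal C(u)&\mathcal D(u)\end{pmatrix}:=T(u-h/2)\,\hat T(u-h/2),\qquad t(u):=e^h\mathcal A(u)+e^{-h}\mathcal D(u),$$ $\bar{\mathcal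 D}(u):=\frac{e^{-h}\sinh(2u)}{\sinh(2u-h)}\mathcal D(u)-\frac{e^{-2u}\sinh h}{\sinh(2u-h)}\mathcal A(u)$, and $\Delta_{\alpha,\zeta}(u):=\sinh(u+h\frac{\alpha-1}2-\zeta)\sinh(u+h\frac{\alpha-1}2+\zeta)$. (a) For all $u$, $\mathcal A(u)|\mathbf 0\rangle=\prod_{i}\sinh(u-\zeta_i+h\tfrac{\alpha_i-1}2)\sinh(u+\zeta_i+h\tfrac{\alpha_i-1}2)\,|\mathbf 0\rangle$, and, if $\sinh(2u-h)\neq0$, $\bar{\mathcal D}(u)|\mathbf 0\rangle=\prod_{i}\sinh(u-\zeta_i-h\tfrac{\alpha_i-1}2)\sinh(u+\zeta_i-h\tfrac{\alpha_i-1}2)\,|\mathbf 0\rangle$. (b) Let $M\ge0$ and let $v_1,\dots,v_M\in\mathbb{C}$ satisfy $\sinh(2v_m)\ne0$ for all $m$ and $\sinh(v_m-v_k)\sinh(v_m+v_k)\neq0$ for $m\ne k$. Put $|\{v_m\}\rangle:=\mathcal B(v_1)\cdots\mathcal B(v_M)|\mathbf 0\rangle$ and $$\begin{aligned}\Lambda(u)={}&\frac{\sinh(2u+h)}{\sinh(2u)}\prod_{i=1}^n\Delta_{\alpha_i,\zeta_i}(u)\prod_{m=1}^M\frac{\sinh(u-v_m-h)\sinh(u+v_m-h)}{\sinh(u-v_m)\sinh(u+v_m)}\\&+\frac{\sinh(2u-h)}{\sinh(2u)}\prod_{i=1}^n\Delta_{\alpha_i,\zeta_i}(-u)\prod_{m=1}^M\frac{\sinh(u-v_m+h)\sinh(u+v_m+h)}{\sinh(u-v_m)\sinh(u+v_m)}.\end{aligned}$$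 Call $u$ regular if $\sinh(2u)\ne0$ and $\sinh(u-v_m)\sinh(u+v_m)\neq0$ for all $m$. Consider the Bethe ansatz equations $$\prod_{i=1}^n\frac{\Delta_{\alpha_i,\zeta_i}(v_m)}{\Delta_{\alpha_i,\zeta_i}(-v_m)}=\prod_{k\neq m}\frac{\sinh(v_m-v_k+h)\sinh(v_m+v_k+h)}{\sinh(v_m-v_k-h)\sinh(v_m+v_k-h)},\qquad 1\le m\le M,\qquad(\ast)$$ and the same equations $(\ast')$ with denominators cleared. (i) If $(\ast')$ holds, then $t(u)|\{v_m\}\rangle=\Lambda(u)|\{v_m\}\rangle$ for all regular $u$. (ii) $|\{v_m\}\rangle$ is an eigenvector (hence nonzero) of $t(u)$ with eigenvalue $\Lambda(u)$ for all regular $u$ if and only if $|\{v_m\}\rangle\ne0$ and $(\ast')$ holds. (iii) If no denominator in $(\ast)$ vanishes, then $|\{v_m\}\rangle$ is an eigenvector of $t(u)$ with eigenvalue $\Lambda(u)$ for all regular $u$ if and only if $|\{v_m\}\rangle\neq0$ and $(\ast)$ holds. -/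

import Mathlib

open scoped TensorProduct

namespace QChain

/-! ### The quantum group -/

/-- The generators of the quantum group of `sl₂`. -/
inductive UqGen
  | E | F | K | Kinv

/-- The defining relations of the quantum group of `sl₂` at deformation parameter `q`. -/
inductive UqRel (q : ℂ) : FreeAlgebra ℂ UqGen → FreeAlgebra ℂ UqGen → Prop
  | KE : UqRel q
      (FreeAlgebra.ι ℂ UqGen.K * FreeAlgebra.ι ℂ UqGen.E * FreeAlgebra.ι ℂ UqGen.Kinv)
      (q ^ 2 • FreeAlgebra.ι ℂ UqGen.E)
  | KF : UqRel q
      (FreeAlgebra.ι ℂ UqGen.K * FreeAlgebra.ι ℂ UqGen.F * FreeAlgebra.ι ℂ UqGen.Kinv)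
      ((q ^ 2)⁻¹ • FreeAlgebra.ι ℂ UqGen.F)
  | EF : UqRel q
      (FreeAlgebra.ι ℂ UqGen.E * FreeAlgebra.ι ℂ UqGen.F
        - FreeAlgebra.ι ℂ UqGen.F * FreeAlgebra.ι ℂ UqGen.E)
      ((q - q⁻¹)⁻¹ • (FreeAlgebra.ι ℂ UqGen.K - FreeAlgebra.ι ℂ UqGen.Kinv))
  | KKinv : UqRel q (FreeAlgebra.ι ℂ UqGen.K * FreeAlgebra.ι ℂ UqGen.Kinv) 1
  | KinvK : UqRel q (FreeAlgebra.ι ℂ UqGen.Kinv * FreeAlgebra.ι ℂ UqGen.K) 1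

/-- The quantum group of `sl₂`, as an associative algebra. -/
abbrev Uq (q : ℂ) : Type := RingQuot (UqRel q)

/-- The class of a generator in the quantum group. -/
noncomputable def Uq.gen (q : ℂ) (x : UqGen) : Uq q :=
  RingQuot.mkAlgHom ℂ (UqRel q) (FreeAlgebra.ι ℂ x)

/-! ### One site: an irreducible highest-weight module

Throughout `q = exp h`. -/

section Site

variable (h α : ℂ) {X : Type*} [AddCommGroup X] [Module ℂ X] [Module (Uq (Complex.exp h)) X]
  [IsScalarTower ℂ (Uq (Complex.exp h)) X]

/-- The operator by which a generator acts on a module. -/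
noncomputable def act (X : Type*) [AddCommGroup X] [Module ℂ X] [Module (Uq (Complex.exp h)) X]
    [IsScalarTower ℂ (Uq (Complex.exp h)) X] (x : UqGen) : Module.End ℂ X :=
  Algebra.lsmul ℂ ℂ X (Uq.gen (Complex.exp h) x)

/-- `w` is a highest-weight vector of weight `q ^ (α - 1)`. -/
structure IsHighestWeight (w : X) : Prop where
  ne_zero : w ≠ 0
  E_apply : act h X UqGen.E w = 0
  K_apply : act h X UqGen.K w = Complex.exp (h * (α - 1)) • w

/-- `L` is the operator `exp (c H)`, where `q ^ H = K` and `H` has the eigenvalue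
`α - 1 - 2 k` on the weight vector `F ^ k w`. -/
def IsExpH (w : X) (c : ℂ) (L : Module.End ℂ X) : Prop :=
  ∀ k : ℕ, L ((act h X UqGen.F ^ k) w)
    = Complex.exp (c * (α - 1 - 2 * k)) • (act h X UqGen.F ^ k) w

/-- The operator `exp (c H)`; it exists and is unique on an irreducible highest-weight module
(see `isExpH_expH` and `IsExpH.unique`). -/
noncomputable def expH (w : X) (c : ℂ) : Module.End ℂ X :=
  Classical.epsilon (IsExpH h α w c)

theorem gen_relations (q : ℂ) :
    Uq.gen q UqGen.K * Uq.gen q UqGen.E * Uq.gen q UqGen.Kinv = q ^ 2 • Uq.gen q UqGen.E ∧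
    Uq.gen q UqGen.K * Uq.gen q UqGen.F * Uq.gen q UqGen.Kinv
      = (q ^ 2)⁻¹ • Uq.gen q UqGen.F ∧
    Uq.gen q UqGen.E * Uq.gen q UqGen.F - Uq.gen q UqGen.F * Uq.gen q UqGen.E
      = (q - q⁻¹)⁻¹ • (Uq.gen q UqGen.K - Uq.gen q UqGen.Kinv) ∧
    Uq.gen q UqGen.K * Uq.gen q UqGen.Kinv = 1 ∧
    Uq.gen q UqGen.Kinv * Uq.gen q UqGen.K = 1 := by
  refine ⟨?_, ?_, ?_, ?_, ?_⟩
  · simpa [Uq.gen] using RingQuot.mkAlgHom_rel ℂ (UqRel.KE (q := q))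
  · simpa [Uq.gen] using RingQuot.mkAlgHom_rel ℂ (UqRel.KF (q := q))
  · simpa [Uq.gen] using RingQuot.mkAlgHom_rel ℂ (UqRel.EF (q := q))
  · simpa [Uq.gen] using RingQuot.mkAlgHom_rel ℂ (UqRel.KKinv (q := q))
  · simpa [Uq.gen] using RingQuot.mkAlgHom_rel ℂ (UqRel.KinvK (q := q))

theorem act_EF : act h X UqGen.E * act h X UqGen.F = act h X UqGen.F * act h X UqGen.E
    + (Complex.exp h - (Complex.exp h)⁻¹)⁻¹ • (act h X UqGen.K - act h X UqGen.Kinv) := by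
  have := congrArg (Algebra.lsmul ℂ ℂ X) (gen_relations (Complex.exp h)).2.2.1
  simp only [map_sub, map_mul, map_smul] at this
  exact sub_eq_iff_eq_add'.mp this

theorem act_KinvK : act h X UqGen.Kinv * act h X UqGen.K = 1 := by
  have := congrArg (Algebra.lsmul ℂ ℂ X) (gen_relations (Complex.exp h)).2.2.2.2
  simp only [map_mul, map_one] at this
  exact this

theorem act_KF : act h X UqGen.K * act h X UqGen.F
    = Complex.exp (-2 * h) • (act h X UqGen.F * act h X UqGen.K) := by
  have := congrArg (Algebra.lsmul ℂ ℂ X) (gen_relations (Complex.exp h)).2.1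
  simp only [map_mul, map_smul] at this
  change act h X UqGen.K * act h X UqGen.F * act h X UqGen.Kinv = _ • act h X UqGen.F at this
  have h2 : (Complex.exp h ^ 2)⁻¹ = Complex.exp (-2 * h) := by
    rw [← Complex.exp_nat_mul, ← Complex.exp_neg]; push_cast; ring_nf
  rw [← h2, ← smul_mul_assoc, ← this, mul_assoc, act_KinvK, mul_one]

variable {h α}

theorem IsHighestWeight.K_pow {w : X} (hw : IsHighestWeight h α w) (k : ℕ) :
    act h X UqGen.K ((act h X UqGen.F ^ k) w)
      = Complex.exp (h * (α - 1 - 2 * k)) • (act h X UqGen.F ^ k) w := by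
  induction k with
  | zero => simpa using hw.K_apply
  | succ k ih =>
    rw [pow_succ', Module.End.mul_apply, ← Module.End.mul_apply, act_KF, LinearMap.smul_apply,
      Module.End.mul_apply, ih, map_smul, smul_smul, ← Complex.exp_add]
    congr 2
    push_cast
    ring

/-- An irreducible highest-weight module is spanned by the vectors `F ^ k w`. -/
theorem IsHighestWeight.span_eq_top [IsSimpleModule (Uq (Complex.exp h)) X] {w : X}
    (hw : IsHighestWeight h α w) :
    Submodule.span ℂ (Set.range fun k : ℕ => (act h X UqGen.F ^ k) w) = ⊤ := by
  set S := Submodule.span ℂ (Set.range fun k : ℕ => (act h X UqGen.F ^ k) w) with hS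
  have mem (k : ℕ) : (act h X UqGen.F ^ k) w ∈ S := Submodule.subset_span ⟨k, rfl⟩
  have stable (L : Module.End ℂ X) (hL : ∀ k : ℕ, L ((act h X UqGen.F ^ k) w) ∈ S) :
      ∀ x ∈ S, L x ∈ S := by
    intro x hx
    have : S ≤ S.comap L := Submodule.span_le.mpr (by rintro _ ⟨k, rfl⟩; exact hL k)
    exact this hx
  have sF : ∀ x ∈ S, act h X UqGen.F x ∈ S := stable _ fun k => by
    have := mem (k + 1); rwa [pow_succ'] at this
  have sK : ∀ x ∈ S, act h X UqGen.K x ∈ S := stable _ fun k => by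
    rw [hw.K_pow]; exact S.smul_mem _ (mem k)
  have sKi : ∀ x ∈ S, act h X UqGen.Kinv x ∈ S := stable _ fun k => by
    have h1 : act h X UqGen.Kinv (act h X UqGen.K ((act h X UqGen.F ^ k) w))
        = (act h X UqGen.F ^ k) w := by
      rw [← Module.End.mul_apply, act_KinvK, Module.End.one_apply]
    rw [hw.K_pow, map_smul] at h1
    have h2 : act h X UqGen.Kinv ((act h X UqGen.F ^ k) w)
        = (Complex.exp (h * (α - 1 - 2 * k)))⁻¹ • (act h X UqGen.F ^ k) w := by
      rw [eq_inv_smul_iff₀ (Complex.exp_ne_zero _), h1]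
    rw [h2]; exact S.smul_mem _ (mem k)
  have sE : ∀ x ∈ S, act h X UqGen.E x ∈ S := stable _ fun k => by
    induction k with
    | zero => simp [hw.E_apply]
    | succ k ih =>
      rw [pow_succ', Module.End.mul_apply, ← Module.End.mul_apply, act_EF]
      simp only [LinearMap.add_apply, LinearMap.smul_apply, LinearMap.sub_apply,
        Module.End.mul_apply]
      exact S.add_mem (sF _ ih) (S.smul_mem _ (S.sub_mem (sK _ (mem k)) (sKi _ (mem k))))
  have all (a : Uq (Complex.exp h)) : ∀ x ∈ S, a • x ∈ S := by
    obtain ⟨b, rfl⟩ := RingQuot.mkAlgHom_surjective ℂ (UqRel (Complex.exp h)) a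
    induction b using FreeAlgebra.induction with
    | grade0 r =>
      intro x hx
      rw [AlgHom.commutes, algebraMap_smul]
      exact S.smul_mem _ hx
    | grade1 g =>
      cases g
      · exact sE
      · exact sF
      · exact sK
      · exact sKi
    | mul a b ha hb =>
      intro x hx
      rw [map_mul, mul_smul]
      exact ha _ (hb _ hx)
    | add a b ha hb =>
      intro x hx
      rw [map_add, add_smul]
      exact S.add_mem (ha _ hx) (hb _ hx)
  let S' : Submodule (Uq (Complex.exp h)) X :=
    { carrier := S, add_mem' := S.add_mem, zero_mem' := S.zero_mem, smul_mem' := fun a x => all a x }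
  have hS' : S' = ⊤ := by
    refine (eq_bot_or_eq_top S').resolve_left fun hbot => hw.ne_zero ?_
    have : w ∈ S' := mem 0
    simpa [hbot] using this
  refine eq_top_iff.mpr fun x _ => ?_
  have : x ∈ S' := by rw [hS']; trivial
  exact this

theorem IsExpH.unique [IsSimpleModule (Uq (Complex.exp h)) X] {w : X}
    (hw : IsHighestWeight h α w) {c : ℂ} {L L' : Module.End ℂ X}
    (hL : IsExpH h α w c L) (hL' : IsExpH h α w c L') : L = L' :=
  LinearMap.ext_on_range hw.span_eq_top fun k => (hL k).trans (hL' k).symm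

/-- `exp h` is not a root of unity. -/
def IsGeneric (h : ℂ) : Prop := ∀ k : ℕ, 0 < k → Complex.exp h ^ k ≠ 1

theorem isExpH_expH (hq : IsGeneric h) [IsSimpleModule (Uq (Complex.exp h)) X] {w : X}
    (hw : IsHighestWeight h α w) (c : ℂ) : IsExpH h α w c (expH h α w c) := by
  refine Classical.epsilon_spec (p := IsExpH h α w c) ?_
  let J := {k : ℕ // (act h X UqGen.F ^ k) w ≠ 0}
  let f : J → X := fun k => (act h X UqGen.F ^ (k : ℕ)) w
  have aux (k l : ℕ) (hkl : k < l)
      (e : Complex.exp (h * (α - 1 - 2 * k)) = Complex.exp (h * (α - 1 - 2 * l))) : False := by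
    refine hq (2 * (l - k)) (by omega) ?_
    have h1 : Complex.exp (h * (α - 1 - 2 * k))
        = Complex.exp (h * (α - 1 - 2 * l)) * Complex.exp h ^ (2 * (l - k)) := by
      rw [← Complex.exp_nat_mul, ← Complex.exp_add]
      congr 1
      push_cast [Nat.cast_sub hkl.le]
      ring
    rw [e] at h1
    exact (mul_eq_left₀ (Complex.exp_ne_zero _)).mp h1.symm
  have li : LinearIndependent ℂ f := by
    refine Module.End.eigenvectors_linearIndependent' (act h X UqGen.K)
      (fun k : J => Complex.exp (h * (α - 1 - 2 * (k : ℕ)))) ?_ f fun k => ?_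
    · intro k l e
      rcases lt_trichotomy (k : ℕ) (l : ℕ) with hlt | heq | hgt
      · exact (aux _ _ hlt e).elim
      · exact Subtype.ext heq
      · exact (aux _ _ hgt e.symm).elim
    · exact Module.End.hasEigenvector_iff.mpr
        ⟨Module.End.mem_eigenspace_iff.mpr (hw.K_pow k), k.2⟩
  have sp : ⊤ ≤ Submodule.span ℂ (Set.range f) := by
    rw [← hw.span_eq_top, Submodule.span_le]
    rintro _ ⟨k, rfl⟩
    by_cases hk : (act h X UqGen.F ^ k) w = 0
    · simp [hk]
    · exact Submodule.subset_span ⟨⟨k, hk⟩, rfl⟩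
  let b := Module.Basis.mk li sp
  refine ⟨b.constr ℂ fun k => Complex.exp (c * (α - 1 - 2 * (k : ℕ))) • f k, fun k => ?_⟩
  by_cases hk : (act h X UqGen.F ^ k) w = 0
  · simp [hk]
  · have hb : (act h X UqGen.F ^ k) w = b ⟨k, hk⟩ := by simp [b, f]
    have h1 := b.constr_basis ℂ (fun k => Complex.exp (c * (α - 1 - 2 * (k : ℕ))) • f k) ⟨k, hk⟩
    rw [← hb] at h1
    exact h1

theorem expH_mul (hq : IsGeneric h) [IsSimpleModule (Uq (Complex.exp h)) X] {w : X}
    (hw : IsHighestWeight h α w) (c d : ℂ) :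
    expH h α w c * expH h α w d = expH h α w (c + d) := by
  refine IsExpH.unique hw (fun k => ?_) (isExpH_expH hq hw (c + d))
  rw [Module.End.mul_apply, isExpH_expH hq hw d, map_smul, isExpH_expH hq hw c, smul_smul,
    ← Complex.exp_add]
  congr 2
  ring

theorem expH_zero (hq : IsGeneric h) [IsSimpleModule (Uq (Complex.exp h)) X] {w : X}
    (hw : IsHighestWeight h α w) : expH h α w 0 = 1 :=
  IsExpH.unique hw (isExpH_expH hq hw 0) fun k => by simp

/-- `q ^ H = K`. -/
theorem expH_self (hq : IsGeneric h) [IsSimpleModule (Uq (Complex.exp h)) X] {w : X}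
    (hw : IsHighestWeight h α w) : expH h α w h = act h X UqGen.K :=
  IsExpH.unique hw (isExpH_expH hq hw h) fun k => hw.K_pow k

/-! #### R-matrices

An operator on `ℂ² ⊗ X` (or on `X ⊗ ℂ²`, the order of the factors being immaterial) is written
as a `2 × 2` matrix with entries in `End X`, in the basis `↑, ↓` of `ℂ²`. On `ℂ²` the generators
act by `E = σ⁺`, `F = σ⁻` and `H = σᶻ`, so only the terms `k = 0, 1` of the universal `R`-matrix
`q ^ (H ⊗ H / 2) ∑ₖ {1} ^ (2 k) / {k}! q ^ (k (k - 1) / 2) E ^ k ⊗ F ^ k` survive,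
where `{1} = q - q⁻¹ = 2 sinh h`. -/

variable (h α)

/-- The factor `q ^ (H ⊗ H / 2)`. -/
noncomputable def cartanR (w : X) : Matrix (Fin 2) (Fin 2) (Module.End ℂ X) :=
  !![expH h α w (h / 2), 0; 0, expH h α w (-(h / 2))]

/-- The universal `R`-matrix evaluated on `ℂ² ⊗ X`. -/
noncomputable def univRLeft (w : X) : Matrix (Fin 2) (Fin 2) (Module.End ℂ X) :=
  cartanR h α w * !![1, (2 * Complex.sinh h) • act h X UqGen.F; 0, 1]

/-- The universal `R`-matrix evaluated on `X ⊗ ℂ²`. -/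
noncomputable def univRRight (w : X) : Matrix (Fin 2) (Fin 2) (Module.End ℂ X) :=
  cartanR h α w * !![1, 0; (2 * Complex.sinh h) • act h X UqGen.E, 1]

/-- The affine `R`-matrix `R(u)` on `ℂ² ⊗ X`. -/
noncomputable def affRLeft (w : X) (u : ℂ) : Matrix (Fin 2) (Fin 2) (Module.End ℂ X) :=
  (Complex.exp (u + h / 2) / 2) • univRLeft h α w
    - (Complex.exp (-u - h / 2) / 2) • Ring.inverse (univRRight h α w)

/-- The affine `R`-matrix `R(u)` on `X ⊗ ℂ²`. -/
noncomputable def affRRight (w : X) (u : ℂ) : Matrix (Fin 2) (Fin 2) (Module.End ℂ X) :=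
  (Complex.exp (u + h / 2) / 2) • univRRight h α w
    - (Complex.exp (-u - h / 2) / 2) • Ring.inverse (univRLeft h α w)

variable {h α}

/-- The inverse in `affRRight` is a genuine one. -/
theorem inverse_univRLeft (hq : IsGeneric h) [IsSimpleModule (Uq (Complex.exp h)) X] {w : X}
    (hw : IsHighestWeight h α w) :
    IsUnit (univRLeft h α w) ∧ Ring.inverse (univRLeft h α w) =
      !![expH h α w (-(h / 2)), -((2 * Complex.sinh h) • (act h X UqGen.F * expH h α w (h / 2)));
        0, expH h α w (h / 2)] := by
  have h1 : expH h α w (h / 2) * expH h α w (-(h / 2)) = 1 := by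
    rw [expH_mul hq hw, add_neg_cancel, expH_zero hq hw]
  have h2 : expH h α w (-(h / 2)) * expH h α w (h / 2) = 1 := by
    rw [expH_mul hq hw, neg_add_cancel, expH_zero hq hw]
  have e1 : univRLeft h α w * !![expH h α w (-(h / 2)),
      -((2 * Complex.sinh h) • (act h X UqGen.F * expH h α w (h / 2)));
        0, expH h α w (h / 2)] = 1 := by
    simp [univRLeft, cartanR, Matrix.one_fin_two, h1, h2, mul_assoc]
  have e2 : !![expH h α w (-(h / 2)),
      -((2 * Complex.sinh h) • (act h X UqGen.F * expH h α w (h / 2)));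
        0, expH h α w (h / 2)] * univRLeft h α w = 1 := by
    simp [univRLeft, cartanR, Matrix.one_fin_two, h1, h2, mul_assoc,
      ← mul_assoc (expH h α w (-(h / 2))) (expH h α w (h / 2))]
  let U : (Matrix (Fin 2) (Fin 2) (Module.End ℂ X))ˣ := ⟨_, _, e1, e2⟩
  exact ⟨U.isUnit, Ring.inverse_unit U⟩

/-- The inverse in `affRLeft` is a genuine one. -/
theorem inverse_univRRight (hq : IsGeneric h) [IsSimpleModule (Uq (Complex.exp h)) X] {w : X}
    (hw : IsHighestWeight h α w) :
    IsUnit (univRRight h α w) ∧ Ring.inverse (univRRight h α w) =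
      !![expH h α w (-(h / 2)), 0;
        -((2 * Complex.sinh h) • (act h X UqGen.E * expH h α w (-(h / 2)))),
        expH h α w (h / 2)] := by
  have h1 : expH h α w (h / 2) * expH h α w (-(h / 2)) = 1 := by
    rw [expH_mul hq hw, add_neg_cancel, expH_zero hq hw]
  have h2 : expH h α w (-(h / 2)) * expH h α w (h / 2) = 1 := by
    rw [expH_mul hq hw, neg_add_cancel, expH_zero hq hw]
  have e1 : univRRight h α w * !![expH h α w (-(h / 2)), 0;
        -((2 * Complex.sinh h) • (act h X UqGen.E * expH h α w (-(h / 2)))),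
        expH h α w (h / 2)] = 1 := by
    simp [univRRight, cartanR, Matrix.one_fin_two, h1, h2, mul_assoc]
  have e2 : !![expH h α w (-(h / 2)), 0;
        -((2 * Complex.sinh h) • (act h X UqGen.E * expH h α w (-(h / 2)))),
        expH h α w (h / 2)] * univRRight h α w = 1 := by
    simp [univRRight, cartanR, Matrix.one_fin_two, h1, h2, mul_assoc,
      ← mul_assoc (expH h α w (h / 2)) (expH h α w (-(h / 2)))]
  let U : (Matrix (Fin 2) (Fin 2) (Module.End ℂ X))ˣ := ⟨_, _, e1, e2⟩
  exact ⟨U.isUnit, Ring.inverse_unit U⟩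

end Site

/-! ### The spin chain -/

section Chain

variable (h : ℂ) {n : ℕ} (α ζ : Fin n → ℂ) {X : Fin n → Type*} [∀ i, AddCommGroup (X i)]
  [∀ i, Module ℂ (X i)] [∀ i, Module (Uq (Complex.exp h)) (X i)]
  [∀ i, IsScalarTower ℂ (Uq (Complex.exp h)) (X i)] (w : ∀ i, X i)

/-- The operator acting by `f` on the `i`-th tensor factor and by the identity on the others. -/
noncomputable def siteOp {n : ℕ} {X : Fin n → Type*} [∀ i, AddCommGroup (X i)]
    [∀ i, Module ℂ (X i)] (i : Fin n) (f : Module.End ℂ (X i)) :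
    Module.End ℂ (⨂[ℂ] i, X i) :=
  PiTensorProduct.map (Function.update (fun j => (LinearMap.id : X j →ₗ[ℂ] X j)) i f)

/-- `T(u) = R_{0,n}(u - ζ_n) ⋯ R_{0,1}(u - ζ_1)`. -/
noncomputable def halfT (u : ℂ) : Matrix (Fin 2) (Fin 2) (Module.End ℂ (⨂[ℂ] i, X i)) :=
  (List.ofFn fun i => (affRLeft h (α i) (w i) (u - ζ i)).map (siteOp i)).reverse.prod

/-- `That(u) = R_{1,0}(u + ζ_1) ⋯ R_{n,0}(u + ζ_n)`. -/
noncomputable def halfThat (u : ℂ) : Matrix (Fin 2) (Fin 2) (Module.End ℂ (⨂[ℂ] i, X i)) :=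
  (List.ofFn fun i => (affRRight h (α i) (w i) (u + ζ i)).map (siteOp i)).prod

/-- The double-row monodromy (with identity `K`-matrix); its entries are the operators
`𝒜(u), ℬ(u), 𝒞(u), 𝒟(u)`. -/
noncomputable def monodromy (u : ℂ) : Matrix (Fin 2) (Fin 2) (Module.End ℂ (⨂[ℂ] i, X i)) :=
  halfT h α ζ w (u - h / 2) * halfThat h α ζ w (u - h / 2)

/-- The operator `𝒜(u)`. -/
noncomputable def opA (u : ℂ) : Module.End ℂ (⨂[ℂ] i, X i) := monodromy h α ζ w u 0 0

/-- The operator `ℬ(u)`. -/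
noncomputable def opB (u : ℂ) : Module.End ℂ (⨂[ℂ] i, X i) := monodromy h α ζ w u 0 1

/-- The operator `𝒟(u)`. -/
noncomputable def opD (u : ℂ) : Module.End ℂ (⨂[ℂ] i, X i) := monodromy h α ζ w u 1 1

/-- The modified operator obtained from `𝒟(u)` by subtracting a multiple of `𝒜(u)`. -/
noncomputable def opDbar (u : ℂ) : Module.End ℂ (⨂[ℂ] i, X i) :=
  (Complex.exp (-h) * Complex.sinh (2 * u) / Complex.sinh (2 * u - h)) • opD h α ζ w u
    - (Complex.exp (-2 * u) * Complex.sinh h / Complex.sinh (2 * u - h)) • opA h α ζ w u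

/-- The transfer matrix, the quantum trace of the monodromy over the auxiliary space. -/
noncomputable def transfer (u : ℂ) : Module.End ℂ (⨂[ℂ] i, X i) :=
  Complex.exp h • opA h α ζ w u + Complex.exp (-h) • opD h α ζ w u

/-- The Bethe vector `ℬ(v_1) ⋯ ℬ(v_M) (w_1 ⊗ ⋯ ⊗ w_n)`. -/
noncomputable def betheVector {M : ℕ} (v : Fin M → ℂ) : ⨂[ℂ] i, X i :=
  (List.ofFn fun m => opB h α ζ w (v m)).prod (PiTensorProduct.tprod ℂ w)

end Chain

/-! ### Eigenvalue and Bethe equations -/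

/-- `Δ_{α,ζ}(u)`. -/
noncomputable def Delta (h α ζ u : ℂ) : ℂ :=
  Complex.sinh (u + h * ((α - 1) / 2) - ζ) * Complex.sinh (u + h * ((α - 1) / 2) + ζ)

section Equations

variable (h : ℂ) {n M : ℕ} (α ζ : Fin n → ℂ) (v : Fin M → ℂ)

/-- The eigenvalue `Λ({v_m}; u)`. -/
noncomputable def Lambda (u : ℂ) : ℂ :=
  Complex.sinh (2 * u + h) / Complex.sinh (2 * u) * (∏ i, Delta h (α i) (ζ i) u)
      * ∏ m, (Complex.sinh (u - v m - h) * Complex.sinh (u + v m - h))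
        / (Complex.sinh (u - v m) * Complex.sinh (u + v m))
    + Complex.sinh (2 * u - h) / Complex.sinh (2 * u) * (∏ i, Delta h (α i) (ζ i) (-u))
      * ∏ m, (Complex.sinh (u - v m + h) * Complex.sinh (u + v m + h))
        / (Complex.sinh (u - v m) * Complex.sinh (u + v m))

/-- `u` is not a pole of the expression for `Λ({v_m}; u)`. -/
def IsRegularPoint (u : ℂ) : Prop :=
  Complex.sinh (2 * u) ≠ 0 ∧
    ∀ m, Complex.sinh (u - v m) ≠ 0 ∧ Complex.sinh (u + v m) ≠ 0

/-- The rapidities are non-degenerate: modulo `iπ`, no `v m` equals its own negative, and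
`v m`, `v k` with `m ≠ k` differ from each other even up to sign. -/
def IsAdmissible : Prop :=
  (∀ m, Complex.sinh (2 * v m) ≠ 0) ∧
    ∀ m k, k ≠ m → Complex.sinh (v m - v k) ≠ 0 ∧ Complex.sinh (v m + v k) ≠ 0

/-- No denominator of the Bethe equations vanishes. -/
def DenominatorsNeZero : Prop :=
  ∀ m, (∀ i, Delta h (α i) (ζ i) (-v m) ≠ 0) ∧
    ∀ k, k ≠ m → Complex.sinh (v m - v k - h) ≠ 0 ∧ Complex.sinh (v m + v k - h) ≠ 0

/-- The Bethe ansatz equations. -/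
def BetheEquations : Prop :=
  ∀ m, ∏ i, Delta h (α i) (ζ i) (v m) / Delta h (α i) (ζ i) (-v m)
    = ∏ k ∈ Finset.univ.erase m,
        (Complex.sinh (v m - v k + h) * Complex.sinh (v m + v k + h))
          / (Complex.sinh (v m - v k - h) * Complex.sinh (v m + v k - h))

/-- The Bethe ansatz equations with denominators cleared. -/
def ClearedBetheEquations : Prop :=
  ∀ m, (∏ i, Delta h (α i) (ζ i) (v m))
        * ∏ k ∈ Finset.univ.erase m,
            Complex.sinh (v m - v k - h) * Complex.sinh (v m + v k - h)
    = (∏ i, Delta h (α i) (ζ i) (-v m))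
        * ∏ k ∈ Finset.univ.erase m,
            Complex.sinh (v m - v k + h) * Complex.sinh (v m + v k + h)

end Equations

end QChain

open QChain

/-! The proof is the algebraic Bethe ansatz for a double-row monodromy `U`, organised so that only
the operators A and B occur.

Two facts about `U` carry everything: the reflection equation, and a crossing relation expressing
sinh(2u - h) U(-u) linearly through U(u). Both hold for the identity matrix, and both survive
multiplication by the two Lax matrices of a further site, one on each side (`IsReflection.dress`).
For one site this is a finite check from the quantum group relations with a square root of K
adjoined.

Crossing makes the modified operator D̄(u) equal to A(-u), makes B(-u) proportional to B(u), and
gives sinh(2u) t(u) = sinh(2u + h) A(u) + sinh(2u - h) A(-u). So the vacuum eigenvalue of D̄ is that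
of A at -u, and only one exchange relation is needed, that of A with B. The vacuum eigenvalue of A
comes from triangularity: E kills the highest-weight vectors.

Moving A(u) through the B(v_m) produces a multiple of the Bethe vector plus unwanted terms, in which
one v_m is replaced by u (`IsBetheSystem.A_creation`). In t(u) the contributions of A(u) and A(-u)
combine, and the m-th unwanted coefficient becomes a multiple of a difference of two weights, at v_m
and -v_m (`IsBetheSystem.transfer_creation`). That difference vanishes exactly when the m-th cleared
Bethe equation holds.

For the converse, linear independence of the unwanted vectors is not needed. If their sum vanishes
for all regular u, its residue at u = v_m is a coefficient times the Bethe vector itself, because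
replacing v_m by v_m changes nothing. A nonzero Bethe vector thus forces each Bethe equation, once
the prefactor sinh(2 v_m - h) is known to be nonzero (`IsBetheSystem.betheWeight_eq`). -/

namespace QChain

/-! ### Lax operators, six-vertex R-matrices and the local relations. -/

section Lax

variable {𝓐 : Type*} [Ring 𝓐]

/-- The action of a `2 × 2` matrix on the first factor of `ℂ² ⊗ ℂ²`. -/
def onFst (M : Matrix (Fin 2) (Fin 2) 𝓐) : Matrix (Fin 2 × Fin 2) (Fin 2 × Fin 2) 𝓐 :=
  Matrix.of fun p r => if p.2 = r.2 then M p.1 r.1 else 0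

/-- The action of a `2 × 2` matrix on the second factor of `ℂ² ⊗ ℂ²`. -/
def onSnd (M : Matrix (Fin 2) (Fin 2) 𝓐) : Matrix (Fin 2 × Fin 2) (Fin 2 × Fin 2) 𝓐 :=
  Matrix.of fun p r => if p.1 = r.1 then M p.2 r.2 else 0

theorem onFst_mul (M N : Matrix (Fin 2) (Fin 2) 𝓐) : onFst (M * N) = onFst M * onFst N := by
  ext ⟨i, j⟩ ⟨l, m⟩
  simp [onFst, Matrix.mul_apply, Fintype.sum_prod_type]

theorem onSnd_mul (M N : Matrix (Fin 2) (Fin 2) 𝓐) : onSnd (M * N) = onSnd M * onSnd N := by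
  ext ⟨i, j⟩ ⟨l, m⟩
  simp [onSnd, Matrix.mul_apply, Fintype.sum_prod_type]

/-- Over a noncommutative ring, acting on different factors is not enough: the entries have to
commute as well. In the chain they do when they come from different sites. -/
theorem onFst_mul_onSnd {M N : Matrix (Fin 2) (Fin 2) 𝓐}
    (H : ∀ i j l m, Commute (M i j) (N l m)) : onFst M * onSnd N = onSnd N * onFst M := by
  ext ⟨i, j⟩ ⟨l, m⟩
  simp [onFst, onSnd, Matrix.mul_apply, Fintype.sum_prod_type, (H i l j m).eq]

/-- The reflection equation is preserved by dressing. -/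
theorem reflection_dress {R R' S S' L₁ L₂ N₁ N₂ M₁ M₂ : Matrix (Fin 2 × Fin 2) (Fin 2 × Fin 2) 𝓐}
    (hLL : R * L₁ * L₂ = L₂ * L₁ * R) (hNN : R' * N₁ * N₂ = N₂ * N₁ * R')
    (hNL : N₁ * S' * L₂ = L₂ * S' * N₁) (hLN : L₁ * S * N₂ = N₂ * S * L₁)
    (hM : R * M₁ * S' * M₂ = M₂ * S * M₁ * R')
    (c₁ : M₁ * L₂ = L₂ * M₁) (c₂ : N₁ * M₂ = M₂ * N₁) (c₃ : L₁ * M₂ = M₂ * L₁)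
    (c₄ : M₁ * N₂ = N₂ * M₁) :
    R * (L₁ * M₁ * N₁) * S' * (L₂ * M₂ * N₂) = (L₂ * M₂ * N₂) * S * (L₁ * M₁ * N₁) * R' := by
  calc R * (L₁ * M₁ * N₁) * S' * (L₂ * M₂ * N₂)
      = R * L₁ * M₁ * (N₁ * S' * L₂) * M₂ * N₂ := by simp only [mul_assoc]
    _ = R * L₁ * (M₁ * L₂) * S' * (N₁ * M₂) * N₂ := by rw [hNL]; simp only [mul_assoc]
    _ = (R * L₁ * L₂) * M₁ * S' * M₂ * N₁ * N₂ := by rw [c₁, c₂]; simp only [mul_assoc]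
    _ = L₂ * L₁ * (R * M₁ * S' * M₂) * N₁ * N₂ := by rw [hLL]; simp only [mul_assoc]
    _ = L₂ * (L₁ * M₂) * S * M₁ * (R' * N₁ * N₂) := by rw [hM]; simp only [mul_assoc]
    _ = L₂ * M₂ * L₁ * S * (M₁ * N₂) * N₁ * R' := by rw [c₃, hNN]; simp only [mul_assoc]
    _ = L₂ * M₂ * (L₁ * S * N₂) * M₁ * N₁ * R' := by rw [c₄]; simp only [mul_assoc]
    _ = (L₂ * M₂ * N₂) * S * (L₁ * M₁ * N₁) * R' := by rw [hLN]; simp only [mul_assoc]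

theorem onFst_one : onFst (1 : Matrix (Fin 2) (Fin 2) 𝓐) = 1 := by
  ext ⟨i, j⟩ ⟨l, m⟩
  fin_cases i <;> fin_cases j <;> fin_cases l <;> fin_cases m <;> simp [onFst, Matrix.one_apply]

theorem onSnd_one : onSnd (1 : Matrix (Fin 2) (Fin 2) 𝓐) = 1 := by
  ext ⟨i, j⟩ ⟨l, m⟩
  fin_cases i <;> fin_cases j <;> fin_cases l <;> fin_cases m <;> simp [onSnd, Matrix.one_apply]

variable [Algebra ℂ 𝓐]

/-- The relations of the quantum group with an adjoined square root `k` of `K`. -/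
structure IsQTriple (q : ℂ) (k k' e f : 𝓐) : Prop where
  k_mul_k' : k * k' = 1
  k'_mul_k : k' * k = 1
  k_mul_e : k * e = q • (e * k)
  k_mul_f : k * f = q⁻¹ • (f * k)
  e_mul_f : e * f = f * e + (q - q⁻¹)⁻¹ • (k * k - k' * k')

/-- The Lax operator with the auxiliary space on the left, in the multiplicative parameter. -/
noncomputable def laxL (q : ℂ) (k k' e f : 𝓐) (x : ℂ) : Matrix (Fin 2) (Fin 2) 𝓐 :=
  !![(x / 2) • k - (x⁻¹ / 2) • k', ((q - q⁻¹) / 2 * x) • (k * f);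
    ((q - q⁻¹) / 2 * x⁻¹) • (e * k'), (x / 2) • k' - (x⁻¹ / 2) • k]

/-- The Lax operator with the auxiliary space on the right, in the multiplicative parameter. -/
noncomputable def laxR (q : ℂ) (k k' e f : 𝓐) (x : ℂ) : Matrix (Fin 2) (Fin 2) 𝓐 :=
  !![(x / 2) • k - (x⁻¹ / 2) • k', ((q - q⁻¹) / 2 * x⁻¹) • (f * k);
    ((q - q⁻¹) / 2 * x) • (k' * e), (x / 2) • k' - (x⁻¹ / 2) • k]

/-- The six-vertex matrix with diagonal weights `a`, `b` and off-diagonal weights `c`, `d`. -/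
def sixVertex (a b c d : ℂ) : Matrix (Fin 2 × Fin 2) (Fin 2 × Fin 2) 𝓐 :=
  Matrix.of fun p r => (if p = r then (if p.1 = p.2 then a else b)
    else if p.1 = r.2 ∧ p.2 = r.1 then (if p.1 = 0 then c else d) else 0) • (1 : 𝓐)

/-- The `R`-matrix on `ℂ² ⊗ ℂ²`, in the multiplicative parameter. -/
noncomputable def rMat (q x : ℂ) : Matrix (Fin 2 × Fin 2) (Fin 2 × Fin 2) 𝓐 :=
  sixVertex ((x * q - (x * q)⁻¹) / 2) ((x - x⁻¹) / 2) ((q - q⁻¹) / 2 * x) ((q - q⁻¹) / 2 * x⁻¹)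

/-- The `R`-matrix on `ℂ² ⊗ ℂ²` with the two factors exchanged. -/
noncomputable def rMatFlip (q x : ℂ) : Matrix (Fin 2 × Fin 2) (Fin 2 × Fin 2) 𝓐 :=
  sixVertex ((x * q - (x * q)⁻¹) / 2) ((x - x⁻¹) / 2) ((q - q⁻¹) / 2 * x⁻¹) ((q - q⁻¹) / 2 * x)

variable {q : ℂ} {k k' e f : 𝓐}

namespace IsQTriple

theorem k'_mul_e (H : IsQTriple q k k' e f) (hq : q ≠ 0) : k' * e = q⁻¹ • (e * k') := by
  have : k' * (k * e) * k' = q • (k' * (e * k) * k') := by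
    rw [H.k_mul_e, mul_smul_comm, smul_mul_assoc]
  rw [← mul_assoc, H.k'_mul_k, one_mul, ← mul_assoc, mul_assoc _ k, H.k_mul_k', mul_one] at this
  rw [this, smul_smul, inv_mul_cancel₀ hq, one_smul]

theorem k'_mul_f (H : IsQTriple q k k' e f) (hq : q ≠ 0) : k' * f = q • (f * k') := by
  have : k' * (k * f) * k' = q⁻¹ • (k' * (f * k) * k') := by
    rw [H.k_mul_f, mul_smul_comm, smul_mul_assoc]
  rw [← mul_assoc, H.k'_mul_k, one_mul, ← mul_assoc, mul_assoc _ k, H.k_mul_k', mul_one] at this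
  rw [this, smul_smul, mul_inv_cancel₀ hq, one_smul]

/-- The rewriting rules that bring a product of generators into the order `f`, `e`, `k`. -/
theorem rules (H : IsQTriple q k k' e f) (hq : q ≠ 0) :
    (k * k' = 1 ∧ k' * k = 1 ∧ k * e = q • (e * k) ∧ k * f = q⁻¹ • (f * k) ∧
      k' * e = q⁻¹ • (e * k') ∧ k' * f = q • (f * k') ∧
      e * f = f * e + (q - q⁻¹)⁻¹ • (k * k - k' * k')) ∧
    ∀ z : 𝓐, k * (k' * z) = z ∧ k' * (k * z) = z ∧ k * (e * z) = q • (e * (k * z)) ∧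
      k * (f * z) = q⁻¹ • (f * (k * z)) ∧ k' * (e * z) = q⁻¹ • (e * (k' * z)) ∧
      k' * (f * z) = q • (f * (k' * z)) ∧
      e * (f * z) = f * (e * z) + (q - q⁻¹)⁻¹ • (k * (k * z) - k' * (k' * z)) := by
  have h := H.k'_mul_e hq
  have h' := H.k'_mul_f hq
  refine ⟨⟨H.k_mul_k', H.k'_mul_k, H.k_mul_e, H.k_mul_f, h, h', H.e_mul_f⟩, fun z => ?_⟩
  simp only [← mul_assoc, H.k_mul_k', H.k'_mul_k, H.k_mul_e, H.k_mul_f, h, h', H.e_mul_f,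
    smul_mul_assoc, one_mul, add_mul, sub_mul, and_self]

end IsQTriple

/-- The RLL relation of a single site. As in the three relations after it, `R` rewrites each of the
sixteen entries into ordered monomials in the generators, and what remains is an identity between
their scalar coefficients. -/
theorem rMat_laxL_laxL (H : IsQTriple q k k' e f) (hq : q ≠ 0) (hq2 : q ^ 2 - 1 ≠ 0)
    {x y : ℂ} (hx : x ≠ 0) (hy : y ≠ 0) :
    rMat q (x / y) * onFst (laxL q k k' e f x) * onSnd (laxL q k k' e f y)
      = onSnd (laxL q k k' e f y) * onFst (laxL q k k' e f x) * rMat q (x / y) := by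
  have R := H.rules hq
  ext ⟨i, j⟩ ⟨l, m⟩
  fin_cases i <;> fin_cases j <;> fin_cases l <;> fin_cases m <;>
  · simp [rMat, sixVertex, onFst, onSnd, laxL, Matrix.mul_apply, Fintype.sum_prod_type,
      add_mul, mul_sub, sub_mul, mul_assoc, R]
    try (match_scalars <;> field_simp <;> ring)

theorem rMatFlip_laxR_laxR (H : IsQTriple q k k' e f) (hq : q ≠ 0) (hq2 : q ^ 2 - 1 ≠ 0)
    {x y : ℂ} (hx : x ≠ 0) (hy : y ≠ 0) :
    rMatFlip q (x / y) * onFst (laxR q k k' e f x) * onSnd (laxR q k k' e f y)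
      = onSnd (laxR q k k' e f y) * onFst (laxR q k k' e f x) * rMatFlip q (x / y) := by
  have R := H.rules hq
  ext ⟨i, j⟩ ⟨l, m⟩
  fin_cases i <;> fin_cases j <;> fin_cases l <;> fin_cases m <;>
  · simp [rMatFlip, sixVertex, onFst, onSnd, laxR, Matrix.mul_apply, Fintype.sum_prod_type,
      add_mul, mul_sub, sub_mul, mul_assoc, R]
    try (match_scalars <;> field_simp <;> ring)

-- Mixed relation between the two rows of the monodromy. The division by q is the shift by h in the
-- argument u + v - h of the reflection equation.
set_option maxHeartbeats 1000000 in
theorem laxR_rMatFlip_laxL (H : IsQTriple q k k' e f) (hq : q ≠ 0) (hq2 : q ^ 2 - 1 ≠ 0)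
    {x y : ℂ} (hx : x ≠ 0) (hy : y ≠ 0) :
    onFst (laxR q k k' e f x) * rMatFlip q (x * y / q) * onSnd (laxL q k k' e f y)
      = onSnd (laxL q k k' e f y) * rMatFlip q (x * y / q) * onFst (laxR q k k' e f x) := by
  have R := H.rules hq
  ext ⟨i, j⟩ ⟨l, m⟩
  fin_cases i <;> fin_cases j <;> fin_cases l <;> fin_cases m <;>
  · simp [rMatFlip, sixVertex, onFst, onSnd, laxL, laxR, Matrix.mul_apply, Fintype.sum_prod_type,
      add_mul, mul_sub, sub_mul, mul_assoc, R]
    try (match_scalars <;> field_simp <;> ring)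

set_option maxHeartbeats 1000000 in
theorem laxL_rMat_laxR (H : IsQTriple q k k' e f) (hq : q ≠ 0) (hq2 : q ^ 2 - 1 ≠ 0)
    {x y : ℂ} (hx : x ≠ 0) (hy : y ≠ 0) :
    onFst (laxL q k k' e f x) * rMat q (x * y / q) * onSnd (laxR q k k' e f y)
      = onSnd (laxR q k k' e f y) * rMat q (x * y / q) * onFst (laxL q k k' e f x) := by
  have R := H.rules hq
  ext ⟨i, j⟩ ⟨l, m⟩
  fin_cases i <;> fin_cases j <;> fin_cases l <;> fin_cases m <;>
  · simp [rMat, sixVertex, onFst, onSnd, laxL, laxR, Matrix.mul_apply, Fintype.sum_prod_type,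
      add_mul, mul_sub, sub_mul, mul_assoc, R]
    try (match_scalars <;> field_simp <;> ring)


/-- The right-hand side of the crossing relation, in the multiplicative parameter. -/
noncomputable def crossed (q t : ℂ) (M : Matrix (Fin 2) (Fin 2) 𝓐) : Matrix (Fin 2) (Fin 2) 𝓐 :=
  !![(q⁻¹ * ((t ^ 2 - (t ^ 2)⁻¹) / 2)) • M 1 1 - ((t ^ 2)⁻¹ * ((q - q⁻¹) / 2)) • M 0 0,
    (-((t ^ 2 * q - (t ^ 2 * q)⁻¹) / 2)) • M 0 1;
    (-((t ^ 2 * q - (t ^ 2 * q)⁻¹) / 2)) • M 1 0,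
    (q * ((t ^ 2 - (t ^ 2)⁻¹) / 2)) • M 0 0 - (t ^ 2 * ((q - q⁻¹) / 2)) • M 1 1]

-- Crossing is compatible with dressing. With t = exp u and z = exp ζ, replacing t by its inverse is
-- u ↦ -u. The inner matrix enters linearly and its entries commute with the generators, so they
-- behave as central symbols in the entrywise check.
set_option maxHeartbeats 1000000 in
theorem crossed_laxL_laxR (H : IsQTriple q k k' e f) (hq : q ≠ 0) (hq2 : q ^ 2 - 1 ≠ 0)
    {t z : ℂ} (ht : t ≠ 0) (hz : z ≠ 0) (M : Matrix (Fin 2) (Fin 2) 𝓐)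
    (hk : ∀ i j, Commute k (M i j)) (hk' : ∀ i j, Commute k' (M i j))
    (he : ∀ i j, Commute e (M i j)) (hf : ∀ i j, Commute f (M i j)) :
    laxL q k k' e f (t⁻¹ / z) * crossed q t M * laxR q k k' e f (t⁻¹ * z)
      = crossed q t (laxL q k k' e f (t / z) * M * laxR q k k' e f (t * z)) := by
  have R := H.rules hq
  have C : ∀ i j, k * M i j = M i j * k ∧ k' * M i j = M i j * k' ∧ e * M i j = M i j * e ∧
      f * M i j = M i j * f := fun i j => ⟨hk i j, hk' i j, he i j, hf i j⟩
  have C' : ∀ i j z, k * (M i j * z) = M i j * (k * z) ∧ k' * (M i j * z) = M i j * (k' * z) ∧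
      e * (M i j * z) = M i j * (e * z) ∧ f * (M i j * z) = M i j * (f * z) := fun i j z =>
    ⟨(hk i j).left_comm z, (hk' i j).left_comm z, (he i j).left_comm z, (hf i j).left_comm z⟩
  ext i j
  fin_cases i <;> fin_cases j <;>
  · simp [crossed, laxL, laxR, Matrix.mul_apply, Matrix.vecMul, dotProduct, mul_add,
      add_mul, mul_sub, sub_mul, mul_assoc, R, C, C']
    match_scalars <;> field_simp <;> ring

/-- The reflection equation for the identity matrix. -/
theorem rMat_mul_rMatFlip (q x y : ℂ) (hq : q ≠ 0) (hx : x ≠ 0) (hy : y ≠ 0) :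
    (rMat q x * rMatFlip q y : Matrix (Fin 2 × Fin 2) (Fin 2 × Fin 2) 𝓐)
      = rMat q y * rMatFlip q x := by
  ext ⟨i, j⟩ ⟨l, m⟩
  fin_cases i <;> fin_cases j <;> fin_cases l <;> fin_cases m <;>
  · simp [rMat, rMatFlip, sixVertex, Matrix.mul_apply, Fintype.sum_prod_type]
    try (match_scalars <;> field_simp <;> ring)

end Lax

/-! ### Continuity of operator families, tested by linear functionals. -/

section ContSum

variable {𝓐 : Type*} [Ring 𝓐] [Algebra ℂ 𝓐]

/-- `f` is a finite sum of constants with continuous scalar coefficients. -/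
def IsContSum (f : ℂ → 𝓐) : Prop :=
  ∃ (ι : Type) (_ : Fintype ι) (g : ι → ℂ → ℂ) (c : ι → 𝓐),
    (∀ i, Continuous (g i)) ∧ ∀ u, f u = ∑ i, g i u • c i

theorem IsContSum.smul_const {g : ℂ → ℂ} (hg : Continuous g) (c : 𝓐) :
    IsContSum fun u => g u • c :=
  ⟨Unit, inferInstance, fun _ => g, fun _ => c, fun _ => hg, fun u => by simp⟩

theorem IsContSum.const (c : 𝓐) : IsContSum fun _ => c := by
  simpa using IsContSum.smul_const (continuous_const (y := (1 : ℂ))) c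

theorem IsContSum.add {f f' : ℂ → 𝓐} (hf : IsContSum f) (hf' : IsContSum f') :
    IsContSum fun u => f u + f' u := by
  obtain ⟨ι, _, g, c, hg, e⟩ := hf
  obtain ⟨ι', _, g', c', hg', e'⟩ := hf'
  refine ⟨ι ⊕ ι', inferInstance, Sum.elim g g', Sum.elim c c', ?_, fun u => ?_⟩
  · rintro (i | i)
    · exact hg i
    · exact hg' i
  · simp [e, e']

theorem IsContSum.mul {f f' : ℂ → 𝓐} (hf : IsContSum f) (hf' : IsContSum f') :
    IsContSum fun u => f u * f' u := by
  obtain ⟨ι, _, g, c, hg, e⟩ := hf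
  obtain ⟨ι', _, g', c', hg', e'⟩ := hf'
  refine ⟨ι × ι', inferInstance, fun p u => g p.1 u * g' p.2 u, fun p => c p.1 * c' p.2,
    fun p => (hg p.1).mul (hg' p.2), fun u => ?_⟩
  simp [e, e', Finset.sum_mul_sum, Fintype.sum_prod_type, smul_smul, mul_comm]

/-- No topology on the operator algebra is involved: an arbitrary linear functional turns such a
finite sum into a continuous scalar function, and functionals separate points. -/
theorem IsContSum.continuous {f : ℂ → 𝓐} (hf : IsContSum f) (φ : 𝓐 →ₗ[ℂ] ℂ) :
    Continuous fun u => φ (f u) := by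
  obtain ⟨ι, _, g, c, hg, e⟩ := hf
  simp only [e, map_sum, map_smul, smul_eq_mul]
  exact continuous_finsetSum _ fun i _ => (hg i).mul continuous_const

end ContSum

/-! ### Removing exceptional values of the spectral parameter. -/

section Density

open Filter Topology

/-- Zeros of sinh are simple, since cosh² - sinh² = 1 forbids a common zero with the derivative;
hence they are isolated. -/
theorem eventually_sinh_ne_zero {c : ℂ} (hc : c ≠ 0) (d z : ℂ) :
    ∀ᶠ u in 𝓝[≠] z, Complex.sinh (c * u + d) ≠ 0 := by
  by_cases h0 : Complex.sinh (c * z + d) = 0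
  · have h1 : HasDerivAt (fun u : ℂ => Complex.sinh (c * u + d))
        (Complex.cosh (c * z + d) * (c * 1)) z :=
      (((hasDerivAt_id z).const_mul c).add_const d).csinh
    refine h1.eventually_ne (mul_ne_zero (fun h2 => ?_) (by simpa using hc))
    simpa [h0, h2] using Complex.cosh_sq_sub_sinh_sq (c * z + d)
  · have : ContinuousAt (fun u : ℂ => Complex.sinh (c * u + d)) z := by fun_prop
    exact (this.eventually_ne h0).filter_mono nhdsWithin_le_nhds

theorem eventually_sinh_sub_ne_zero (d z : ℂ) : ∀ᶠ u in 𝓝[≠] z, Complex.sinh (u - d) ≠ 0 := by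
  simpa [sub_eq_add_neg] using eventually_sinh_ne_zero one_ne_zero (-d) z

theorem eventually_sinh_add_ne_zero (d z : ℂ) : ∀ᶠ u in 𝓝[≠] z, Complex.sinh (u + d) ≠ 0 := by
  simpa using eventually_sinh_ne_zero one_ne_zero d z

theorem eq_zero_of_eventually_eq_zero {F : ℂ → ℂ} {z : ℂ} (hF : ContinuousAt F z)
    (h0 : ∀ᶠ u in 𝓝[≠] z, F u = 0) : F z = 0 :=
  tendsto_nhds_unique (hF.tendsto.mono_left nhdsWithin_le_nhds)
    (tendsto_const_nhds.congr' (h0.mono fun _ e => e.symm))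

end Density

/-! ### The reflection equation, crossing, and the exchange relations they imply. -/

section Reflection

variable {𝓐 : Type*} [Ring 𝓐] [Algebra ℂ 𝓐] {h : ℂ}

/-- The properties of the double-row monodromy: the reflection equation and the crossing relation,
with continuous dependence on the spectral parameter. -/
structure IsReflection (h : ℂ) (U : ℂ → Matrix (Fin 2) (Fin 2) 𝓐) : Prop where
  refl : ∀ u v, rMat (Complex.exp h) (Complex.exp u / Complex.exp v) * onFst (U u)
        * rMatFlip (Complex.exp h) (Complex.exp u * Complex.exp v / Complex.exp h) * onSnd (U v)
      = onSnd (U v) * rMat (Complex.exp h) (Complex.exp u * Complex.exp v / Complex.exp h)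
        * onFst (U u) * rMatFlip (Complex.exp h) (Complex.exp u / Complex.exp v)
  cross : ∀ u, Complex.sinh (2 * u - h) • U (-u) = crossed (Complex.exp h) (Complex.exp u) (U u)
  cont : ∀ i j, IsContSum fun u => U u i j

/-- Rational expression of hyperbolic and exponential functions. -/
theorem sinh_eq (x : ℂ) : Complex.sinh x = (Complex.exp x - (Complex.exp x)⁻¹) / 2 := by
  rw [Complex.sinh, Complex.exp_neg]

theorem exp_two_mul (x : ℂ) : Complex.exp (2 * x) = Complex.exp x ^ 2 := by
  rw [← Complex.exp_nat_mul]; norm_num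

theorem isReflection_one : IsReflection h fun _ => (1 : Matrix (Fin 2) (Fin 2) 𝓐) where
  refl u v := by
    simp only [onFst_one, onSnd_one, mul_one, one_mul]
    exact rMat_mul_rMatFlip _ _ _ (Complex.exp_ne_zero _)
      (div_ne_zero (Complex.exp_ne_zero _) (Complex.exp_ne_zero _))
      (div_ne_zero (mul_ne_zero (Complex.exp_ne_zero _) (Complex.exp_ne_zero _))
        (Complex.exp_ne_zero _))
  cross u := by
    have hu := Complex.exp_ne_zero u
    have hh := Complex.exp_ne_zero h
    ext i j
    fin_cases i <;> fin_cases j <;> simp [crossed]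
    all_goals
      match_scalars
      simp only [sinh_eq, Complex.exp_sub, exp_two_mul]
      field_simp
      ring
  cont i j := IsContSum.const _

/-- The inductive step that adds a site. The commutation hypotheses say that the operators of the
new site commute with those already present in `U`. -/
theorem IsReflection.dress {U : ℂ → Matrix (Fin 2) (Fin 2) 𝓐} (HU : IsReflection h U)
    (hh : Complex.exp h ^ 2 - 1 ≠ 0) {k k' e f : 𝓐} (H : IsQTriple (Complex.exp h) k k' e f)
    (ζ : ℂ) (hk : ∀ u i j, Commute k (U u i j)) (hk' : ∀ u i j, Commute k' (U u i j))
    (he : ∀ u i j, Commute e (U u i j)) (hf : ∀ u i j, Commute f (U u i j)) :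
    IsReflection h fun u => laxL (Complex.exp h) k k' e f (Complex.exp (u - ζ)) * U u
      * laxR (Complex.exp h) k k' e f (Complex.exp (u + ζ)) where
  refl u v := by
    have q0 := Complex.exp_ne_zero h
    have c₁ (x u : ℂ) (i j l m : Fin 2) :
        Commute (laxL (Complex.exp h) k k' e f x i j) (U u l m) := by
      have a1 := hk u l m
      have a2 := hk' u l m
      have a3 := he u l m
      have a4 := hf u l m
      fin_cases i <;> fin_cases j <;> simp only [laxL, Matrix.of_apply, Matrix.cons_val',
        Fin.zero_eta, Fin.mk_one, Matrix.cons_val_zero, Matrix.cons_val_one,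
        Matrix.cons_val_fin_one]
      · exact (a1.smul_left _).sub_left (a2.smul_left _)
      · exact (a1.mul_left a4).smul_left _
      · exact (a3.mul_left a2).smul_left _
      · exact (a2.smul_left _).sub_left (a1.smul_left _)
    have c₂ (x u : ℂ) (i j l m : Fin 2) :
        Commute (laxR (Complex.exp h) k k' e f x i j) (U u l m) := by
      have a1 := hk u l m
      have a2 := hk' u l m
      have a3 := he u l m
      have a4 := hf u l m
      fin_cases i <;> fin_cases j <;> simp only [laxR, Matrix.of_apply, Matrix.cons_val',
        Fin.zero_eta, Fin.mk_one, Matrix.cons_val_zero, Matrix.cons_val_one,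
        Matrix.cons_val_fin_one]
      · exact (a1.smul_left _).sub_left (a2.smul_left _)
      · exact (a4.mul_left a1).smul_left _
      · exact (a2.mul_left a3).smul_left _
      · exact (a2.smul_left _).sub_left (a1.smul_left _)
    -- The inhomogeneity drops out of all R-matrix arguments: the two rows carry -ζ and +ζ, so it
    -- cancels in differences within a row and in sums across rows.
    have e1 : Complex.exp (u - ζ) / Complex.exp (v - ζ) = Complex.exp u / Complex.exp v := by
      rw [← Complex.exp_sub, ← Complex.exp_sub]; congr 1; ring
    have e2 : Complex.exp (u + ζ) / Complex.exp (v + ζ) = Complex.exp u / Complex.exp v := by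
      rw [← Complex.exp_sub, ← Complex.exp_sub]; congr 1; ring
    have e3 : Complex.exp (u - ζ) * Complex.exp (v + ζ) = Complex.exp u * Complex.exp v := by
      rw [← Complex.exp_add, ← Complex.exp_add]; congr 1; ring
    have e4 : Complex.exp (u + ζ) * Complex.exp (v - ζ) = Complex.exp u * Complex.exp v := by
      rw [← Complex.exp_add, ← Complex.exp_add]; congr 1; ring
    simp only [onFst_mul, onSnd_mul]
    refine reflection_dress ?_ ?_ ?_ ?_ (HU.refl u v) ?_ ?_ ?_ ?_
    · rw [← e1]
      exact rMat_laxL_laxL H q0 hh (Complex.exp_ne_zero _) (Complex.exp_ne_zero _)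
    · rw [← e2]
      exact rMatFlip_laxR_laxR H q0 hh (Complex.exp_ne_zero _) (Complex.exp_ne_zero _)
    · rw [← e4]
      exact laxR_rMatFlip_laxL H q0 hh (Complex.exp_ne_zero _) (Complex.exp_ne_zero _)
    · rw [← e3]
      exact laxL_rMat_laxR H q0 hh (Complex.exp_ne_zero _) (Complex.exp_ne_zero _)
    · exact onFst_mul_onSnd fun i j l m => (c₁ _ _ _ _ _ _).symm
    · exact onFst_mul_onSnd fun i j l m => c₂ _ _ _ _ _ _
    · exact onFst_mul_onSnd fun i j l m => c₁ _ _ _ _ _ _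
    · exact onFst_mul_onSnd fun i j l m => (c₂ _ _ _ _ _ _).symm
  cross u := by
    have := crossed_laxL_laxR H (Complex.exp_ne_zero h) hh (Complex.exp_ne_zero u)
      (Complex.exp_ne_zero ζ) (U u) (hk u) (hk' u) (he u) (hf u)
    rw [← HU.cross, ← Complex.exp_neg, ← Complex.exp_sub, ← Complex.exp_sub, ← Complex.exp_add,
      ← Complex.exp_add] at this
    rw [← this, mul_smul_comm, smul_mul_assoc]
  cont i j := by
    have cL (i j : Fin 2) :
        IsContSum fun u => laxL (Complex.exp h) k k' e f (Complex.exp (u - ζ)) i j := by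
      fin_cases i <;> fin_cases j <;> simp only [laxL, Matrix.of_apply, Matrix.cons_val',
        Fin.zero_eta, Fin.mk_one, Matrix.cons_val_zero, Matrix.cons_val_one,
        Matrix.cons_val_fin_one, ← Complex.exp_neg, sub_eq_add_neg _ (_ • _), ← neg_smul]
      · exact (IsContSum.smul_const (by fun_prop) _).add (IsContSum.smul_const (by fun_prop) _)
      · exact IsContSum.smul_const (by fun_prop) _
      · exact IsContSum.smul_const (by fun_prop) _
      · exact (IsContSum.smul_const (by fun_prop) _).add (IsContSum.smul_const (by fun_prop) _)
    have cR (i j : Fin 2) :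
        IsContSum fun u => laxR (Complex.exp h) k k' e f (Complex.exp (u + ζ)) i j := by
      fin_cases i <;> fin_cases j <;> simp only [laxR, Matrix.of_apply, Matrix.cons_val',
        Fin.zero_eta, Fin.mk_one, Matrix.cons_val_zero, Matrix.cons_val_one,
        Matrix.cons_val_fin_one, ← Complex.exp_neg, sub_eq_add_neg _ (_ • _), ← neg_smul]
      · exact (IsContSum.smul_const (by fun_prop) _).add (IsContSum.smul_const (by fun_prop) _)
      · exact IsContSum.smul_const (by fun_prop) _
      · exact IsContSum.smul_const (by fun_prop) _
      · exact (IsContSum.smul_const (by fun_prop) _).add (IsContSum.smul_const (by fun_prop) _)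
    simp only [Matrix.mul_apply, Fin.sum_univ_two]
    have cU := HU.cont
    exact ((((cL i 0).mul (cU 0 0)).add ((cL i 1).mul (cU 1 0))).mul (cR 0 j)).add
      ((((cL i 0).mul (cU 0 1)).add ((cL i 1).mul (cU 1 1))).mul (cR 1 j))

namespace IsReflection

variable {U : ℂ → Matrix (Fin 2) (Fin 2) 𝓐}

/-- Off-diagonal part of crossing. It is kept undivided because either sine may vanish. -/
theorem cross_B (HU : IsReflection h U) (u : ℂ) :
    Complex.sinh (2 * u - h) • U (-u) 0 1 = (-Complex.sinh (2 * u + h)) • U u 0 1 := by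
  have := congrFun (congrFun (HU.cross u) 0) 1
  simpa [crossed, sinh_eq, Complex.exp_add, exp_two_mul] using this

/-- Diagonal part of crossing; the right-hand side is sinh(2u - h) times the modified operator
D̄(u). -/
theorem cross_A (HU : IsReflection h U) (u : ℂ) :
    Complex.sinh (2 * u - h) • U (-u) 0 0
      = (Complex.exp (-h) * Complex.sinh (2 * u)) • U u 1 1
        - (Complex.exp (-2 * u) * Complex.sinh h) • U u 0 0 := by
  have := congrFun (congrFun (HU.cross u) 0) 0
  have e : Complex.exp (-2 * u) = (Complex.exp u ^ 2)⁻¹ := by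
    rw [neg_mul, Complex.exp_neg, exp_two_mul]
  rw [e, Complex.exp_neg]
  simpa [crossed, sinh_eq, exp_two_mul] using this

/-- The exchange relation of `A` and `B`. -/
theorem exchange_AB (HU : IsReflection h U) (u v : ℂ) :
    (Complex.sinh (u - v) * Complex.sinh (u + v)) • (U u 0 0 * U v 0 1)
      = (Complex.sinh (u - v - h) * Complex.sinh (u + v - h)) • (U v 0 1 * U u 0 0)
        + (Complex.sinh h * Complex.exp (u - v) * Complex.sinh (u + v - h))
          • (U u 0 1 * U v 0 0)
        - (Complex.sinh h * Complex.sinh (u - v) * Complex.exp (u + v - h))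
          • (U u 0 1 * U v 1 1) := by
  -- The spectral parameters are interchanged, so that this entry moves A(u) to the right of B(v).
  have := congrFun (congrFun (HU.refl v u) (0, 0)) (1, 0)
  simp [rMat, rMatFlip, sixVertex, onFst, onSnd, Matrix.mul_apply, Fintype.sum_prod_type,
    mul_add, add_mul, mul_assoc] at this
  have hu := Complex.exp_ne_zero u
  have hv := Complex.exp_ne_zero v
  have hh := Complex.exp_ne_zero h
  linear_combination (norm := skip) this
  match_scalars
  all_goals
    simp only [sinh_eq, Complex.exp_sub, Complex.exp_add]
    field_simp
    ring

/-- The exchange relation of `A` and `B`, with `D` eliminated by crossing. -/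
theorem exchange (HU : IsReflection h U) (u v : ℂ) :
    (Complex.sinh (2 * v) * Complex.sinh (u - v) * Complex.sinh (u + v)) • (U u 0 0 * U v 0 1)
      = (Complex.sinh (2 * v) * Complex.sinh (u - v - h) * Complex.sinh (u + v - h))
          • (U v 0 1 * U u 0 0)
        + (Complex.sinh h * Complex.exp (u - v) * Complex.sinh (u + v)
          * Complex.sinh (2 * v - h)) • (U u 0 1 * U v 0 0)
        - (Complex.sinh h * Complex.exp (u + v) * Complex.sinh (u - v)
          * Complex.sinh (2 * v - h)) • (U u 0 1 * U (-v) 0 0) := by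
  have h1 := HU.exchange_AB u v
  have h2 := congrArg (U u 0 1 * ·) (HU.cross_A v)
  simp only [mul_sub, mul_smul_comm] at h2
  have hu := Complex.exp_ne_zero u
  have hv := Complex.exp_ne_zero v
  have hh := Complex.exp_ne_zero h
  linear_combination (norm := skip) Complex.sinh (2 * v) • h1
    + (Complex.sinh h * Complex.sinh (u - v) * Complex.exp (u + v)) • h2
  match_scalars
  all_goals
    simp only [sinh_eq, Complex.exp_sub, Complex.exp_add, Complex.exp_neg, neg_mul, exp_two_mul]
    field_simp
    ring

/-- The reflection equation yields commutativity only up to the factor sinh(u - v + h) sinh(u + v -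
h). At zeros of this factor it follows by continuity in u. -/
theorem commute_B (HU : IsReflection h U) (u v : ℂ) : U u 0 1 * U v 0 1 = U v 0 1 * U u 0 1 := by
  rw [← sub_eq_zero, ← Module.forall_dual_apply_eq_zero_iff ℂ]
  intro φ
  have hc : IsContSum fun u => U u 0 1 * U v 0 1 + (-1) * U v 0 1 * U u 0 1 :=
    ((HU.cont 0 1).mul (.const _)).add (IsContSum.mul (.const _) (HU.cont 0 1))
  have := eq_zero_of_eventually_eq_zero (z := u) (hc.continuous φ).continuousAt ?_
  · rwa [sub_eq_add_neg, ← neg_one_mul, ← mul_assoc]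
  filter_upwards [eventually_sinh_sub_ne_zero (v - h) u, eventually_sinh_add_ne_zero (v - h) u]
    with x h1 h2
  have := congrFun (congrFun (HU.refl x v) (0, 0)) (1, 1)
  simp [rMat, rMatFlip, sixVertex, onFst, onSnd, Matrix.mul_apply, Fintype.sum_prod_type] at this
  have e1 : (Complex.exp x / Complex.exp v * Complex.exp h
      - (Complex.exp h)⁻¹ * (Complex.exp v / Complex.exp x)) / 2
      = Complex.sinh (x - (v - h)) := by
    simp only [sinh_eq, Complex.exp_sub]
    field_simp
  have e2 : (Complex.exp x * Complex.exp v / Complex.exp h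
      - Complex.exp h / (Complex.exp x * Complex.exp v)) / 2 = Complex.sinh (x + (v - h)) := by
    simp only [sinh_eq, Complex.exp_sub, Complex.exp_add]
    field_simp
  rw [e1, e2] at this
  have hφ := congrArg φ this
  simp only [map_smul, smul_eq_mul] at hφ
  refine mul_left_cancel₀ (mul_ne_zero h1 h2) ?_
  rw [map_add, neg_one_mul, neg_mul, map_neg]
  linear_combination hφ

end IsReflection
end Reflection

/-! ### The abstract algebraic Bethe ansatz. -/

section Bethe

variable {V : Type*} [AddCommGroup V] [Module ℂ V]

/-- The relations on which the algebraic Bethe ansatz rests. -/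
structure IsBetheSystem (h : ℂ) (A B : ℂ → Module.End ℂ V) (a : ℂ → ℂ) (ψ : V) : Prop where
  comm : ∀ u v, B u * B v = B v * B u
  exchange : ∀ u v,
    (Complex.sinh (2 * v) * Complex.sinh (u - v) * Complex.sinh (u + v)) • (A u * B v)
      = (Complex.sinh (2 * v) * Complex.sinh (u - v - h) * Complex.sinh (u + v - h)) • (B v * A u)
        + (Complex.sinh h * Complex.exp (u - v) * Complex.sinh (u + v)
          * Complex.sinh (2 * v - h)) • (B u * A v)
        - (Complex.sinh h * Complex.exp (u + v) * Complex.sinh (u - v)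
          * Complex.sinh (2 * v - h)) • (B u * A (-v))
  cross : ∀ u, Complex.sinh (2 * u - h) • B (-u) = (-Complex.sinh (2 * u + h)) • B u
  vacuum : ∀ u, A u ψ = a u • ψ

/-- The Bethe vector of a family of creation operators. -/
def creation (B : ℂ → Module.End ℂ V) (ψ : V) {M : ℕ} (v : Fin M → ℂ) : V :=
  (List.ofFn fun m => B (v m)).prod ψ

theorem creation_succ (B : ℂ → Module.End ℂ V) (ψ : V) {M : ℕ} (v : Fin (M + 1) → ℂ) :
    creation B ψ v = B (v 0) (creation B ψ fun m => v m.succ) := by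
  simp [creation, List.ofFn_succ]

theorem update_comp_succ {M : ℕ} (v : Fin (M + 1) → ℂ) (j : Fin M) (x : ℂ) :
    (fun m : Fin M => Function.update v j.succ x m.succ)
      = Function.update (fun m => v m.succ) j x := by
  ext m
  simp [Function.update_apply]

theorem prod_erase_zero {M : ℕ} (f : Fin (M + 1) → ℂ) :
    ∏ k ∈ Finset.univ.erase 0, f k = ∏ k : Fin M, f k.succ := by
  rw [← Finset.filter_ne', Finset.prod_filter, Fin.prod_univ_succ]
  simp

theorem prod_erase_succ {M : ℕ} (f : Fin (M + 1) → ℂ) (j : Fin M) :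
    ∏ k ∈ Finset.univ.erase j.succ, f k = f 0 * ∏ k ∈ Finset.univ.erase j, f k.succ := by
  rw [← Finset.filter_ne', ← Finset.filter_ne', Finset.prod_filter, Finset.prod_filter,
    Fin.prod_univ_succ]
  simp [(Fin.succ_ne_zero j).symm]

/-- The factor picked up when `A(x)` is moved past `B(w)`. -/
noncomputable def exchangeFactor (h x w : ℂ) : ℂ :=
  (Complex.sinh (x - w - h) * Complex.sinh (x + w - h))
    / (Complex.sinh (x - w) * Complex.sinh (x + w))

/-- The weight of the unwanted term in which `v m` has been replaced, evaluated at `x = ± v m`. -/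
noncomputable def betheWeight (h : ℂ) (a : ℂ → ℂ) {M : ℕ} (v : Fin M → ℂ) (m : Fin M) (x : ℂ) : ℂ :=
  a x * ∏ k ∈ Finset.univ.erase m, exchangeFactor h x (v k)

/-- A partial fraction expansion in u with kernel exp(u - p) / sinh(u - p) = 1 + coth(u - p). The
first term on the left has simple poles at v, w and -w modulo iπ, and it tends to 0 as Re u → -∞, as
the kernel does; so it is the sum of its residues times kernels. -/
theorem exchangeFactor_identity (h : ℂ) {u v w : ℂ} (h1 : Complex.sinh (2 * w) ≠ 0)
    (h2 : Complex.sinh (u - w) ≠ 0) (h3 : Complex.sinh (u + w) ≠ 0)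
    (h4 : Complex.sinh (u - v) ≠ 0) (h5 : Complex.sinh (v - w) ≠ 0)
    (h6 : Complex.sinh (v + w) ≠ 0) :
    exchangeFactor h u w * (Complex.exp (u - v) / Complex.sinh (u - v))
      + Complex.sinh h * Complex.sinh (2 * w - h) / Complex.sinh (2 * w)
        * (Complex.exp (u - w) / Complex.sinh (u - w))
        * (Complex.exp (w - v) / Complex.sinh (w - v))
      + Complex.sinh h * Complex.sinh (2 * w + h) / Complex.sinh (2 * w)
        * (Complex.exp (u + w) / Complex.sinh (u + w))
        * (Complex.exp (-w - v) / Complex.sinh (-w - v))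
      = exchangeFactor h v w * (Complex.exp (u - v) / Complex.sinh (u - v)) := by
  have hu := Complex.exp_ne_zero u
  have hv := Complex.exp_ne_zero v
  have hw := Complex.exp_ne_zero w
  have hh := Complex.exp_ne_zero h
  have e1 : Complex.sinh (w - v) = -Complex.sinh (v - w) := by rw [← Complex.sinh_neg, neg_sub]
  have e2 : Complex.sinh (-w - v) = -Complex.sinh (v + w) := by
    rw [← Complex.sinh_neg]; congr 1; ring
  rw [e1, e2]
  unfold exchangeFactor
  -- Denominators are cleared while the sines are still atoms known to be nonzero; only afterwards
  -- are they expanded into exponentials.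
  generalize e3 : Complex.sinh (2 * w) = S at h1 ⊢
  generalize e4 : Complex.sinh (2 * w - h) = S'
  generalize e5 : Complex.sinh (2 * w + h) = S''
  field_simp
  subst e3 e4 e5
  simp only [sinh_eq, Complex.exp_sub, Complex.exp_add, Complex.exp_neg, exp_two_mul]
  field_simp
  ring

/-- Both quotients have the form 1 + coth, so the left side is coth(u - v) + coth(u + v). The result
is even in v, which lets the terms of v_m and -v_m share one coefficient in the transfer matrix. -/
theorem exp_div_sinh_identity {u v : ℂ} (h1 : Complex.sinh (u - v) ≠ 0)
    (h2 : Complex.sinh (u + v) ≠ 0) :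
    Complex.exp (u - v) / Complex.sinh (u - v) - Complex.exp (-u - v) / Complex.sinh (-u - v)
      = Complex.sinh (2 * u) / (Complex.sinh (u - v) * Complex.sinh (u + v)) := by
  have hu := Complex.exp_ne_zero u
  have hv := Complex.exp_ne_zero v
  have e2 : Complex.sinh (-u - v) = -Complex.sinh (u + v) := by
    rw [← Complex.sinh_neg]; congr 1; ring
  rw [e2]
  generalize e3 : Complex.sinh (2 * u) = S
  field_simp
  subst e3
  simp only [sinh_eq, Complex.exp_sub, Complex.exp_add, Complex.exp_neg, exp_two_mul]
  field_simp
  ring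

open Filter Topology in
theorem eventually_isRegularPoint {M : ℕ} (v : Fin M → ℂ) (z : ℂ) :
    ∀ᶠ u in 𝓝[≠] z, IsRegularPoint v u := by
  refine Filter.Eventually.and ?_ (eventually_all.mpr fun m => ?_)
  · simpa using eventually_sinh_ne_zero two_ne_zero 0 z
  · exact (eventually_sinh_sub_ne_zero _ z).and (eventually_sinh_add_ne_zero _ z)

namespace IsBetheSystem

variable {h : ℂ} {A B : ℂ → Module.End ℂ V} {a : ℂ → ℂ} {ψ : V}

/-- Commutativity of the B's brings the m-th one to the front; the vector it then acts on does not
depend on x. -/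
theorem exists_creation_update (H : IsBetheSystem h A B a ψ) {M : ℕ} (v : Fin M → ℂ) (m : Fin M) :
    ∃ ψ' : V, ∀ x, creation B ψ (Function.update v m x) = B x ψ' := by
  induction M with
  | zero => exact m.elim0
  | succ M ih =>
    cases m using Fin.cases with
    | zero =>
      refine ⟨creation B ψ fun m => v m.succ, fun x => ?_⟩
      simp [creation_succ]
    | succ j =>
      obtain ⟨ψ', e⟩ := ih (fun m => v m.succ) j
      refine ⟨B (v 0) ψ', fun x => ?_⟩
      rw [creation_succ, update_comp_succ, e, ← Module.End.mul_apply, ← Module.End.mul_apply,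
        H.comm]
      simp [(Fin.succ_ne_zero j).symm]

theorem swap (H : IsBetheSystem h A B a ψ) {M : ℕ} (v : Fin M → ℂ) (m : Fin M) (x y : ℂ) :
    B x (creation B ψ (Function.update v m y)) = B y (creation B ψ (Function.update v m x)) := by
  obtain ⟨ψ', e⟩ := H.exists_creation_update v m
  rw [e, e, ← Module.End.mul_apply, ← Module.End.mul_apply, H.comm]

theorem creation_update_neg (H : IsBetheSystem h A B a ψ) {M : ℕ} (v : Fin M → ℂ) (m : Fin M)
    (x : ℂ) : Complex.sinh (2 * x - h) • creation B ψ (Function.update v m (-x))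
      = (-Complex.sinh (2 * x + h)) • creation B ψ (Function.update v m x) := by
  obtain ⟨ψ', e⟩ := H.exists_creation_update v m
  rw [e, e, ← LinearMap.smul_apply, H.cross, LinearMap.smul_apply]

theorem exchange_div (H : IsBetheSystem h A B a ψ) {u w : ℂ} (h1 : Complex.sinh (2 * w) ≠ 0)
    (h2 : Complex.sinh (u - w) ≠ 0) (h3 : Complex.sinh (u + w) ≠ 0) (x : V) :
    A u (B w x) = exchangeFactor h u w • B w (A u x)
      + (Complex.sinh h * Complex.sinh (2 * w - h) / Complex.sinh (2 * w)
        * (Complex.exp (u - w) / Complex.sinh (u - w))) • B u (A w x)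
      - (Complex.sinh h * Complex.sinh (2 * w - h) / Complex.sinh (2 * w)
        * (Complex.exp (u + w) / Complex.sinh (u + w))) • B u (A (-w) x) := by
  have e := congrArg (fun L : Module.End ℂ V => L x) (H.exchange u w)
  simp only [LinearMap.add_apply, LinearMap.sub_apply, LinearMap.smul_apply,
    Module.End.mul_apply] at e
  have h0 := mul_ne_zero (mul_ne_zero h1 h2) h3
  rw [← smul_right_injective V h0 |>.eq_iff]
  rw [e]
  unfold exchangeFactor
  generalize Complex.sinh (2 * w) = S at h1 ⊢
  match_scalars <;> field_simp

/-- The action of `A` on an off-shell Bethe vector. -/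
theorem A_creation (H : IsBetheSystem h A B a ψ) {M : ℕ} (v : Fin M → ℂ) (hv : IsAdmissible v)
    {u : ℂ} (hu : ∀ m, Complex.sinh (u - v m) ≠ 0 ∧ Complex.sinh (u + v m) ≠ 0) :
    A u (creation B ψ v) = (a u * ∏ m, exchangeFactor h u (v m)) • creation B ψ v
      + ∑ m, (Complex.sinh h * Complex.sinh (2 * v m - h) / Complex.sinh (2 * v m)
        * (Complex.exp (u - v m) / Complex.sinh (u - v m) * betheWeight h a v m (v m)
          - Complex.exp (u + v m) / Complex.sinh (u + v m) * betheWeight h a v m (-v m)))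
        • creation B ψ (Function.update v m u) := by
  induction M generalizing u with
  | zero => simpa [creation] using H.vacuum u
  | succ M ih =>
    set w := v 0 with hw
    set v' : Fin M → ℂ := fun m => v m.succ with hv'
    have hadm : IsAdmissible v' := ⟨fun m => hv.1 _, fun m k hk => hv.2 _ _ (by simpa using hk)⟩
    have n1 (m : Fin M) := hv.2 0 m.succ (Fin.succ_ne_zero m)
    have n2 (m : Fin M) := hv.2 m.succ 0 (Fin.succ_ne_zero m).symm
    -- Moving A(u) past the first B(w) leaves A at u, w and -w, so the induction hypothesis is used
    -- at these three points. Admissibility keeps w and -w away from the remaining ±v_m.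
    have i1 := ih v' hadm (u := u) fun m => hu _
    have i2 := ih v' hadm (u := w) fun m => n1 m
    have i3 := ih v' hadm (u := -w) fun m => by
      refine ⟨?_, ?_⟩
      · rw [show -w - v' m = -(w + v m.succ) by rw [hv', neg_add'], Complex.sinh_neg]
        exact neg_ne_zero.mpr (n1 m).2
      · rw [show -w + v' m = -(w - v m.succ) by rw [hv', neg_sub, neg_add_eq_sub], Complex.sinh_neg]
        exact neg_ne_zero.mpr (n1 m).1
    -- The three contributions in which the j-th remaining rapidity has been replaced (by u, w and
    -- -w) merge into a single unwanted term.
    have key (j : Fin M) :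
        exchangeFactor h u w • (Complex.sinh h * Complex.sinh (2 * v' j - h)
            / Complex.sinh (2 * v' j)
            * (Complex.exp (u - v' j) / Complex.sinh (u - v' j) * betheWeight h a v' j (v' j)
              - Complex.exp (u + v' j) / Complex.sinh (u + v' j) * betheWeight h a v' j (-v' j)))
            • B w (creation B ψ (Function.update v' j u))
          + (Complex.sinh h * Complex.sinh (2 * w - h) / Complex.sinh (2 * w)
            * (Complex.exp (u - w) / Complex.sinh (u - w)))
            • (Complex.sinh h * Complex.sinh (2 * v' j - h) / Complex.sinh (2 * v' j)
            * (Complex.exp (w - v' j) / Complex.sinh (w - v' j) * betheWeight h a v' j (v' j)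
              - Complex.exp (w + v' j) / Complex.sinh (w + v' j) * betheWeight h a v' j (-v' j)))
            • B u (creation B ψ (Function.update v' j w))
          - (Complex.sinh h * Complex.sinh (2 * w - h) / Complex.sinh (2 * w)
            * (Complex.exp (u + w) / Complex.sinh (u + w)))
            • (Complex.sinh h * Complex.sinh (2 * v' j - h) / Complex.sinh (2 * v' j)
            * (Complex.exp (-w - v' j) / Complex.sinh (-w - v' j) * betheWeight h a v' j (v' j)
              - Complex.exp (-w + v' j) / Complex.sinh (-w + v' j)
                * betheWeight h a v' j (-v' j)))
            • B u (creation B ψ (Function.update v' j (-w)))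
        = (Complex.sinh h * Complex.sinh (2 * v j.succ - h) / Complex.sinh (2 * v j.succ)
            * (Complex.exp (u - v j.succ) / Complex.sinh (u - v j.succ)
                * betheWeight h a v j.succ (v j.succ)
              - Complex.exp (u + v j.succ) / Complex.sinh (u + v j.succ)
                * betheWeight h a v j.succ (-v j.succ)))
            • creation B ψ (Function.update v j.succ u) := by
      rw [creation_succ, update_comp_succ, Function.update_of_ne (Fin.succ_ne_zero _).symm]
      change _ = (Complex.sinh h * Complex.sinh (2 * v' j - h) / Complex.sinh (2 * v' j)
            * (Complex.exp (u - v' j) / Complex.sinh (u - v' j)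
                * betheWeight h a v j.succ (v' j)
              - Complex.exp (u + v' j) / Complex.sinh (u + v' j)
                * betheWeight h a v j.succ (-v' j)))
            • B w (creation B ψ (Function.update v' j u))
      -- After swapping, B(w) or B(-w) is in front and u is in slot j; crossing turns sinh(2w - h)
      -- B(-w) into a multiple of B(w), so all three vectors agree.
      rw [H.swap v' j u w, H.swap v' j u (-w)]
      have hc := congrArg (fun L : Module.End ℂ V => L (creation B ψ (Function.update v' j u)))
        (H.cross w)
      simp only [LinearMap.smul_apply] at hc
      -- The identity is used at v_j and at -v_j, once for each of the two weights of the unwanted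
      -- term.
      have a1 := exchangeFactor_identity h (v := v' j) (hv.1 0) (hu 0).1 (hu 0).2 (hu j.succ).1
        (n2 j).1 (n2 j).2
      have a2 := exchangeFactor_identity h (v := -v' j) (hv.1 0) (hu 0).1 (hu 0).2
        (by simpa using (hu j.succ).2)
        (by
          rw [← neg_add', Complex.sinh_neg]
          exact neg_ne_zero.mpr (n2 j).2)
        (by
          rw [neg_add_eq_sub]
          exact (n1 j).1)
      simp only [sub_neg_eq_add] at a2
      have w1 (x : ℂ) : betheWeight h a v j.succ x
          = exchangeFactor h x w * betheWeight h a v' j x := by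
        simp only [betheWeight, prod_erase_succ, hw, hv']
        ring
      rw [w1, w1]
      generalize betheWeight h a v' j (v' j) = P at *
      generalize betheWeight h a v' j (-v' j) = Q at *
      linear_combination (norm := skip) -(Complex.sinh h / Complex.sinh (2 * w)
            * (Complex.exp (u + w) / Complex.sinh (u + w))
            * (Complex.sinh h * Complex.sinh (2 * v' j - h) / Complex.sinh (2 * v' j)
            * (Complex.exp (-w - v' j) / Complex.sinh (-w - v' j) * P
              - Complex.exp (-w + v' j) / Complex.sinh (-w + v' j)
                * Q))) • hc
      match_scalars
      · linear_combination Complex.sinh h * Complex.sinh (2 * v' j - h)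
            / Complex.sinh (2 * v' j) * (P * a1 - Q * a2)
      · ring
    have u0 : (fun m : Fin M => Function.update v 0 u m.succ) = v' := by
      ext m; simp [hv']
    rw [Fin.sum_univ_succ, Fin.prod_univ_succ, Finset.sum_congr rfl fun j _ => (key j).symm,
      creation_succ, creation_succ, u0, Function.update_self,
      H.exchange_div (hv.1 0) (hu 0).1 (hu 0).2, i1, i2, i3]
    simp only [map_add, map_smul, map_sum, Finset.sum_add_distrib, Finset.sum_sub_distrib,
      smul_add, Finset.smul_sum, betheWeight, prod_erase_zero]
    module

/-- The action of the transfer matrix on an off-shell Bethe vector. -/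
theorem transfer_creation (H : IsBetheSystem h A B a ψ) {M : ℕ} (v : Fin M → ℂ)
    (hv : IsAdmissible v) {u : ℂ} (hu : IsRegularPoint v u) {t : Module.End ℂ V}
    (ht : Complex.sinh (2 * u) • t
      = Complex.sinh (2 * u + h) • A u + Complex.sinh (2 * u - h) • A (-u)) :
    t (creation B ψ v)
      = (Complex.sinh (2 * u + h) / Complex.sinh (2 * u) * a u * ∏ m, exchangeFactor h u (v m)
          + Complex.sinh (2 * u - h) / Complex.sinh (2 * u) * a (-u)
            * ∏ m, exchangeFactor h (-u) (v m)) • creation B ψ v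
      + ∑ m, (Complex.sinh (2 * u + h) * (Complex.sinh h * Complex.sinh (2 * v m - h)
          / Complex.sinh (2 * v m)) * (betheWeight h a v m (v m) - betheWeight h a v m (-v m))
          / (Complex.sinh (u - v m) * Complex.sinh (u + v m)))
        • creation B ψ (Function.update v m u) := by
  have e1 (m : Fin M) : Complex.sinh (-u - v m) = -Complex.sinh (u + v m) := by
    rw [← Complex.sinh_neg]; congr 1; ring
  have e2 (m : Fin M) : Complex.sinh (-u + v m) = -Complex.sinh (u - v m) := by
    rw [← Complex.sinh_neg]; congr 1; ring
  have i1 := H.A_creation v hv (u := u) hu.2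
  have i2 := H.A_creation v hv (u := -u) fun m => by
    rw [e1, e2]
    exact ⟨neg_ne_zero.mpr (hu.2 m).2, neg_ne_zero.mpr (hu.2 m).1⟩
  have ht' := congrArg (fun L : Module.End ℂ V => L (creation B ψ v)) ht
  simp only [LinearMap.add_apply, LinearMap.smul_apply, i1, i2, smul_add, Finset.smul_sum] at ht'
  -- The unwanted vectors of A(-u) are reduced to those of A(u) by crossing, after which the
  -- coefficients add up through `exp_div_sinh_identity`, which supplies the factor sinh(2u).
  have key (m : Fin M) :
      Complex.sinh (2 * u)
          • (Complex.sinh (2 * u + h) * (Complex.sinh h * Complex.sinh (2 * v m - h)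
          / Complex.sinh (2 * v m)) * (betheWeight h a v m (v m) - betheWeight h a v m (-v m))
          / (Complex.sinh (u - v m) * Complex.sinh (u + v m)))
        • creation B ψ (Function.update v m u)
      = Complex.sinh (2 * u + h) • (Complex.sinh h * Complex.sinh (2 * v m - h)
          / Complex.sinh (2 * v m)
        * (Complex.exp (u - v m) / Complex.sinh (u - v m) * betheWeight h a v m (v m)
          - Complex.exp (u + v m) / Complex.sinh (u + v m) * betheWeight h a v m (-v m)))
        • creation B ψ (Function.update v m u)
      + Complex.sinh (2 * u - h) • (Complex.sinh h * Complex.sinh (2 * v m - h)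
          / Complex.sinh (2 * v m)
        * (Complex.exp (-u - v m) / Complex.sinh (-u - v m) * betheWeight h a v m (v m)
          - Complex.exp (-u + v m) / Complex.sinh (-u + v m) * betheWeight h a v m (-v m)))
        • creation B ψ (Function.update v m (-u)) := by
    have hc := H.creation_update_neg v m u
    have a1 := exp_div_sinh_identity (hu.2 m).1 (hu.2 m).2
    have a2 := exp_div_sinh_identity (u := u) (v := -v m) (by simpa using (hu.2 m).2)
      (by simpa [← sub_eq_add_neg] using (hu.2 m).1)
    simp only [sub_neg_eq_add, ← sub_eq_add_neg] at a2
    generalize betheWeight h a v m (v m) = P at *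
    generalize betheWeight h a v m (-v m) = Q at *
    linear_combination (norm := skip) -(Complex.sinh h * Complex.sinh (2 * v m - h)
          / Complex.sinh (2 * v m)
        * (Complex.exp (-u - v m) / Complex.sinh (-u - v m) * P
          - Complex.exp (-u + v m) / Complex.sinh (-u + v m) * Q)) • hc
    match_scalars
    · linear_combination -(Complex.sinh (2 * u + h) * (Complex.sinh h
        * Complex.sinh (2 * v m - h) / Complex.sinh (2 * v m))) * (P * a1 - Q * a2)
    · ring
  rw [← smul_right_injective V hu.1 |>.eq_iff]
  rw [ht', smul_add, Finset.smul_sum, Finset.sum_congr rfl fun m _ => key m,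
    Finset.sum_add_distrib]
  have hs := hu.1
  generalize Complex.sinh (2 * u) = S at hs ⊢
  have c1 : S • (Complex.sinh (2 * u + h) / S * a u * ∏ m, exchangeFactor h u (v m)
      + Complex.sinh (2 * u - h) / S * a (-u) * ∏ m, exchangeFactor h (-u) (v m))
        • creation B ψ v
      = Complex.sinh (2 * u + h) • (a u * ∏ m, exchangeFactor h u (v m)) • creation B ψ v
        + Complex.sinh (2 * u - h) • (a (-u) * ∏ m, exchangeFactor h (-u) (v m))
          • creation B ψ v := by
    match_scalars
    field_simp
  rw [c1]
  abel

open Filter Topology in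
/-- An off-shell Bethe vector that is an eigenvector with the expected eigenvalue is on shell. -/
theorem betheWeight_eq (H : IsBetheSystem h A B a ψ) (h1 : Complex.sinh h ≠ 0)
    (h2 : Complex.sinh (2 * h) ≠ 0) (hB : ∀ x (φ : V →ₗ[ℂ] ℂ), Continuous fun u => φ (B u x))
    {M : ℕ} (v : Fin M → ℂ) (hv : IsAdmissible v) (h0 : creation B ψ v ≠ 0)
    (hs : ∀ u, IsRegularPoint v u →
      ∑ m, (Complex.sinh (2 * u + h) * (Complex.sinh h * Complex.sinh (2 * v m - h)
          / Complex.sinh (2 * v m)) * (betheWeight h a v m (v m) - betheWeight h a v m (-v m))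
          / (Complex.sinh (u - v m) * Complex.sinh (u + v m)))
        • creation B ψ (Function.update v m u) = 0) (m : Fin M) :
    betheWeight h a v m (v m) = betheWeight h a v m (-v m) := by
  obtain ⟨φ, hφ⟩ : ∃ φ : V →ₗ[ℂ] ℂ, φ (creation B ψ v) ≠ 0 := by
    by_contra! hc
    exact h0 ((Module.forall_dual_apply_eq_zero_iff ℂ _).mp hc)
  -- If this vanished, crossing at v_m would make sinh(2 v_m + h) times the Bethe vector zero. But
  -- then sinh(2 v_m + h) = cosh(2 v_m - h) sinh(2h), which is nonzero, contradicting `h0`.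
  have hne : Complex.sinh (2 * v m - h) ≠ 0 := by
    intro hz
    obtain ⟨ψ', e⟩ := H.exists_creation_update v m
    have ec := e (v m)
    rw [Function.update_eq_self] at ec
    have hc := congrArg (fun L : Module.End ℂ V => L ψ') (H.cross (v m))
    simp only [LinearMap.smul_apply, hz, zero_smul, ← ec] at hc
    have hp : Complex.sinh (2 * v m + h) ≠ 0 := by
      rw [show 2 * v m + h = (2 * v m - h) + 2 * h by ring, Complex.sinh_add, hz, zero_mul,
        zero_add]
      refine mul_ne_zero (fun hz' => ?_) h2
      simpa [hz, hz'] using Complex.cosh_sq_sub_sinh_sq (2 * v m - h)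
    exact (smul_ne_zero (neg_ne_zero.mpr hp) h0) hc.symm
  set g : Fin M → ℂ := fun j => Complex.sinh h * Complex.sinh (2 * v j - h)
    / Complex.sinh (2 * v j) * (betheWeight h a v j (v j) - betheWeight h a v j (-v j)) with hg
  -- The vanishing sum, seen through φ and multiplied by sinh(u - v_m) sinh(u + v_m) / sinh(2u + h).
  -- This removes the pole at v_m, and the other summands vanish there.
  set F : ℂ → ℂ := fun u => g m * φ (creation B ψ (Function.update v m u))
    + ∑ j ∈ Finset.univ.erase m, g j * (Complex.sinh (u - v m) * Complex.sinh (u + v m)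
      / (Complex.sinh (u - v j) * Complex.sinh (u + v j)))
      * φ (creation B ψ (Function.update v j u)) with hF
  have hcont (j : Fin M) : Continuous fun u => φ (creation B ψ (Function.update v j u)) := by
    obtain ⟨ψ', e⟩ := H.exists_creation_update v j
    simpa only [e] using hB ψ' φ
  have hFc : ContinuousAt F (v m) := by
    refine (continuous_const.mul (hcont m)).continuousAt.add
      (tendsto_finsetSum _ fun j hj => ?_)
    have hjm := hv.2 m j (Finset.ne_of_mem_erase hj)
    refine ContinuousAt.mul (continuousAt_const.mul (ContinuousAt.div (by fun_prop) (by fun_prop)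
      (mul_ne_zero hjm.1 hjm.2))) (hcont j).continuousAt
  have hF0 : F (v m) = 0 := by
    refine eq_zero_of_eventually_eq_zero hFc ?_
    -- sinh(2u + h) may vanish at v_m itself, so the division is made only in a punctured
    -- neighbourhood.
    filter_upwards [eventually_isRegularPoint v (v m),
      eventually_sinh_ne_zero two_ne_zero h (v m)] with u hu hu'
    have hsum := congrArg φ (hs u hu)
    rw [map_zero, map_sum, ← Finset.add_sum_erase _ _ (Finset.mem_univ m)] at hsum
    simp only [map_smul, smul_eq_mul] at hsum
    have hum := mul_ne_zero (hu.2 m).1 (hu.2 m).2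
    refine mul_left_cancel₀ (div_ne_zero hu' hum) ?_
    rw [mul_zero, ← hsum, hF, mul_add, Finset.mul_sum]
    congr 1
    · simp only [hg]
      ring
    · refine Finset.sum_congr rfl fun j _ => ?_
      have := (hu.2 m).1
      have := (hu.2 m).2
      simp only [hg]
      generalize Complex.sinh (u - v m) = S at *
      generalize Complex.sinh (u + v m) = S' at *
      field_simp
  rw [hF] at hF0
  simp only [sub_self, Complex.sinh_zero, zero_mul, zero_div, mul_zero, Finset.sum_const_zero,
    add_zero, Function.update_eq_self] at hF0
  have hgm := (mul_eq_zero.mp hF0).resolve_right hφ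
  exact sub_eq_zero.mp ((mul_eq_zero.mp hgm).resolve_left
    (div_ne_zero (mul_ne_zero h1 hne) (hv.1 m)))

end IsBetheSystem
end Bethe

/-! ### Operators on single tensor factors. -/

section SiteOperators

variable {n : ℕ} {X : Fin n → Type*} [∀ i, AddCommGroup (X i)] [∀ i, Module ℂ (X i)]

theorem siteOp_one (i : Fin n) : siteOp i (1 : Module.End ℂ (X i)) = 1 := by
  have : Function.update (fun j => (LinearMap.id : X j →ₗ[ℂ] X j)) i (1 : Module.End ℂ (X i))
      = fun _ => 1 := Function.update_eq_self i (fun j => (LinearMap.id : X j →ₗ[ℂ] X j))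
  rw [siteOp, this, PiTensorProduct.map_one]

theorem siteOp_mul (i : Fin n) (f g : Module.End ℂ (X i)) :
    siteOp i (f * g) = siteOp i f * siteOp i g := by
  rw [siteOp, siteOp, siteOp, ← PiTensorProduct.map_mul]
  congr 1
  ext1 j
  by_cases hj : j = i
  · subst hj; simp
  · simp only [Function.update_of_ne hj]; rfl

/-- The operators on one tensor factor, as an algebra homomorphism. -/
noncomputable def siteHom (i : Fin n) : Module.End ℂ (X i) →ₐ[ℂ] Module.End ℂ (⨂[ℂ] i, X i) :=
  AlgHom.ofLinearMap
    { toFun := siteOp i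
      map_add' := fun f g => PiTensorProduct.map_update_add _ i f g
      map_smul' := fun c f => PiTensorProduct.map_update_smul _ i c f }
    (siteOp_one i) (siteOp_mul i)

theorem siteHom_apply (i : Fin n) (f : Module.End ℂ (X i)) : siteHom i f = siteOp i f := rfl

theorem siteHom_commute {i j : Fin n} (hij : i ≠ j) (f : Module.End ℂ (X i))
    (g : Module.End ℂ (X j)) : Commute (siteHom i f) (siteHom j g) := by
  rw [commute_iff_eq, siteHom_apply, siteHom_apply, siteOp, siteOp, ← PiTensorProduct.map_mul,
    ← PiTensorProduct.map_mul]
  congr 1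
  ext1 l
  by_cases hi : l = i
  · subst hi
    simp only [Function.update_self, Function.update_of_ne hij]
    rfl
  · by_cases hj : l = j
    · subst hj
      simp only [Function.update_self, Function.update_of_ne hi]
      rfl
    · simp only [Function.update_of_ne hi, Function.update_of_ne hj]

theorem siteHom_tprod (i : Fin n) (f : Module.End ℂ (X i)) (w : ∀ i, X i) {c : ℂ}
    (hf : f (w i) = c • w i) :
    siteHom i f (PiTensorProduct.tprod ℂ w) = c • PiTensorProduct.tprod ℂ w := by
  rw [siteHom_apply, siteOp, PiTensorProduct.map_tprod]
  have : (fun j => Function.update (fun j => (LinearMap.id : X j →ₗ[ℂ] X j)) i f j (w j))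
      = Function.update w i (c • w i) := by
    ext j
    by_cases hj : j = i
    · subst hj; simp [hf]
    · simp [Function.update_of_ne hj]
  rw [this, MultilinearMap.map_update_smul, Function.update_eq_self]

end SiteOperators

/-! ### The quantum group relations and Lax form of one site. -/

section Site

variable {h α : ℂ} {X : Type*} [AddCommGroup X] [Module ℂ X] [Module (Uq (Complex.exp h)) X]
  [IsScalarTower ℂ (Uq (Complex.exp h)) X]

theorem IsGeneric.sinh_ne_zero (hq : IsGeneric h) {k : ℕ} (hk : 0 < k) :
    Complex.sinh (k * h) ≠ 0 := by
  intro h0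
  refine hq (2 * k) (by omega) ?_
  have e1 : Complex.exp (k * h) = Complex.exp (-(k * h)) := by
    rw [Complex.sinh, div_eq_zero_iff, sub_eq_zero] at h0
    simpa using h0
  rw [← Complex.exp_nat_mul, show ((2 * k : ℕ) : ℂ) * h = k * h + k * h by push_cast; ring,
    Complex.exp_add]
  nth_rw 1 [e1]
  rw [← Complex.exp_add, neg_add_cancel, Complex.exp_zero]

/-- `E` lowers the index of the weight vectors. -/
theorem IsHighestWeight.E_pow_succ {w : X} (hw : IsHighestWeight h α w) (k : ℕ) :
    ∃ c : ℂ, act h X UqGen.E ((act h X UqGen.F ^ (k + 1)) w) = c • (act h X UqGen.F ^ k) w := by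
  have hKi (k : ℕ) : act h X UqGen.Kinv ((act h X UqGen.F ^ k) w)
      = (Complex.exp (h * (α - 1 - 2 * k)))⁻¹ • (act h X UqGen.F ^ k) w := by
    rw [eq_inv_smul_iff₀ (Complex.exp_ne_zero _), ← map_smul, ← hw.K_pow, ← Module.End.mul_apply,
      act_KinvK, Module.End.one_apply]
  have step (k : ℕ) : act h X UqGen.E ((act h X UqGen.F ^ (k + 1)) w)
      = act h X UqGen.F (act h X UqGen.E ((act h X UqGen.F ^ k) w))
        + (Complex.exp h - (Complex.exp h)⁻¹)⁻¹ • (Complex.exp (h * (α - 1 - 2 * k))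
          - (Complex.exp (h * (α - 1 - 2 * k)))⁻¹) • (act h X UqGen.F ^ k) w := by
    rw [pow_succ', Module.End.mul_apply, ← Module.End.mul_apply, act_EF]
    simp only [LinearMap.add_apply, LinearMap.smul_apply, LinearMap.sub_apply,
      Module.End.mul_apply, hw.K_pow, hKi, sub_smul]
  induction k with
  | zero =>
    rw [step]
    simp only [pow_zero, Module.End.one_apply, hw.E_apply, map_zero, zero_add, smul_smul]
    exact ⟨_, rfl⟩
  | succ k ih =>
    obtain ⟨c, hc⟩ := ih
    rw [step, hc, map_smul, ← Module.End.mul_apply, ← pow_succ', smul_smul, ← add_smul]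
    exact ⟨_, rfl⟩

/-- The relations with the square root of K are checked on the spanning vectors F^k w, where it acts
by scalars; E and F shift the index by one, which gives the factors q and q⁻¹. -/
theorem isQTriple (hq : IsGeneric h) [IsSimpleModule (Uq (Complex.exp h)) X] {w : X}
    (hw : IsHighestWeight h α w) :
    IsQTriple (Complex.exp h) (expH h α w (h / 2)) (expH h α w (-(h / 2)))
      (act h X UqGen.E) (act h X UqGen.F) where
  k_mul_k' := by rw [expH_mul hq hw, add_neg_cancel, expH_zero hq hw]
  k'_mul_k := by rw [expH_mul hq hw, neg_add_cancel, expH_zero hq hw]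
  k_mul_e := by
    refine LinearMap.ext_on_range hw.span_eq_top fun k => ?_
    have hk := isExpH_expH hq hw (h / 2)
    rw [LinearMap.smul_apply, Module.End.mul_apply, Module.End.mul_apply, hk, map_smul]
    cases k with
    | zero => simp [hw.E_apply]
    | succ k =>
      obtain ⟨c, hc⟩ := hw.E_pow_succ k
      rw [hc, map_smul, hk, smul_smul, smul_smul, smul_smul, ← Complex.exp_add, mul_comm c]
      congr 3
      push_cast
      ring
  k_mul_f := by
    refine LinearMap.ext_on_range hw.span_eq_top fun k => ?_
    have hk := isExpH_expH hq hw (h / 2)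
    have hk' := hk (k + 1)
    rw [pow_succ', Module.End.mul_apply] at hk'
    rw [LinearMap.smul_apply, Module.End.mul_apply, Module.End.mul_apply, hk, map_smul, hk',
      smul_smul, ← Complex.exp_neg, ← Complex.exp_add]
    congr 2
    push_cast
    ring
  e_mul_f := by
    have e1 : expH h α w (h / 2) * expH h α w (h / 2) = act h X UqGen.K := by
      rw [expH_mul hq hw, add_halves, expH_self hq hw]
    have e2 : act h X UqGen.Kinv = expH h α w (-(h / 2)) * expH h α w (-(h / 2)) := by
      have : act h X UqGen.K * (expH h α w (-(h / 2)) * expH h α w (-(h / 2))) = 1 := by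
        rw [← expH_self hq hw, expH_mul hq hw, expH_mul hq hw, ← neg_add, add_halves,
          add_neg_cancel, expH_zero hq hw]
      rw [← mul_one (act h X UqGen.Kinv), ← this, ← mul_assoc, act_KinvK, one_mul]
    rw [e1, ← e2]
    exact act_EF h

theorem affRLeft_eq (hq : IsGeneric h) [IsSimpleModule (Uq (Complex.exp h)) X] {w : X}
    (hw : IsHighestWeight h α w) (u : ℂ) :
    affRLeft h α w u = laxL (Complex.exp h) (expH h α w (h / 2)) (expH h α w (-(h / 2)))
      (act h X UqGen.E) (act h X UqGen.F) (Complex.exp (u + h / 2)) := by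
  rw [affRLeft, (inverse_univRRight hq hw).2, univRLeft, cartanR,
    show -u - h / 2 = -(u + h / 2) by ring, Complex.exp_neg]
  ext1 i j
  fin_cases i <;> fin_cases j <;> simp [laxL, sinh_eq]
  all_goals module

theorem affRRight_eq (hq : IsGeneric h) [IsSimpleModule (Uq (Complex.exp h)) X] {w : X}
    (hw : IsHighestWeight h α w) (u : ℂ) :
    affRRight h α w u = laxR (Complex.exp h) (expH h α w (h / 2)) (expH h α w (-(h / 2)))
      (act h X UqGen.E) (act h X UqGen.F) (Complex.exp (u + h / 2)) := by
  rw [affRRight, (inverse_univRLeft hq hw).2, univRRight, cartanR,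
    show -u - h / 2 = -(u + h / 2) by ring, Complex.exp_neg]
  ext1 i j
  fin_cases i <;> fin_cases j <;> simp [laxR, sinh_eq]
  all_goals module

end Site

/-- The first column of `M` acts on `x` as on a highest-weight vector, with eigenvalue `c`. -/
def IsVacuum {V : Type*} [AddCommGroup V] [Module ℂ V] (x : V)
    (M : Matrix (Fin 2) (Fin 2) (Module.End ℂ V)) (c : ℂ) : Prop :=
  M 0 0 x = c • x ∧ M 1 0 x = 0

theorem IsVacuum.mul {V : Type*} [AddCommGroup V] [Module ℂ V] {x : V}
    {M N : Matrix (Fin 2) (Fin 2) (Module.End ℂ V)} {c d : ℂ} (hM : IsVacuum x M c)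
    (hN : IsVacuum x N d) : IsVacuum x (M * N) (c * d) := by
  constructor
  · simp [Matrix.mul_apply, hM.1, hN.1, hN.2, smul_smul, mul_comm]
  · simp [Matrix.mul_apply, hM.2, hN.1, hN.2]

/-! ### The monodromy of the chain: reflection, crossing and vacuum. -/

section Chain

variable {h : ℂ} {n : ℕ} {α : Fin n → ℂ} (ζ : Fin n → ℂ) {X : Fin n → Type*}
  [∀ i, AddCommGroup (X i)] [∀ i, Module ℂ (X i)] [∀ i, Module (Uq (Complex.exp h)) (X i)]
  [∀ i, IsScalarTower ℂ (Uq (Complex.exp h)) (X i)] {w : ∀ i, X i}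

variable (h α w) in
/-- The double-row monodromy of a list of sites. -/
noncomputable def listMonodromy (l : List (Fin n)) (u : ℂ) :
    Matrix (Fin 2) (Fin 2) (Module.End ℂ (⨂[ℂ] i, X i)) :=
  (l.map fun i => (affRLeft h (α i) (w i) (u - h / 2 - ζ i)).map (siteOp i)).reverse.prod
    * (l.map fun i => (affRRight h (α i) (w i) (u - h / 2 + ζ i)).map (siteOp i)).prod

/-- A new last site is outermost on both sides, since the left product is reversed. All operators
act on the full tensor product, so induction on the list never changes the space. -/
theorem listMonodromy_append (l : List (Fin n)) (i : Fin n) (u : ℂ) :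
    listMonodromy h α ζ w (l ++ [i]) u
      = (affRLeft h (α i) (w i) (u - h / 2 - ζ i)).map (siteOp i) * listMonodromy h α ζ w l u
        * (affRRight h (α i) (w i) (u - h / 2 + ζ i)).map (siteOp i) := by
  simp [listMonodromy, mul_assoc]

theorem monodromy_eq (u : ℂ) :
    monodromy h α ζ w u = listMonodromy h α ζ w (List.finRange n) u := by
  rw [monodromy, halfT, halfThat, listMonodromy, List.ofFn_eq_map, List.ofFn_eq_map]

theorem siteHom_commute_listMonodromy (l : List (Fin n)) {i : Fin n} (hi : i ∉ l)
    (f : Module.End ℂ (X i)) (u : ℂ) (a b : Fin 2) :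
    Commute (siteHom i f) (listMonodromy h α ζ w l u a b) := by
  induction l using List.reverseRecOn generalizing a b with
  | nil =>
    simp only [listMonodromy, List.map_nil, List.reverse_nil, List.prod_nil, mul_one,
      Matrix.one_apply]
    split_ifs
    · exact Commute.one_right _
    · exact Commute.zero_right _
  | append_singleton l j ih =>
    rw [List.mem_append, List.mem_singleton, not_or] at hi
    rw [listMonodromy_append]
    simp only [Matrix.mul_apply, Fin.sum_univ_two, Matrix.map_apply, ← siteHom_apply]
    have c (g : Module.End ℂ (X j)) := siteHom_commute hi.2 f g
    have c' := ih hi.1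
    have c'' (a b : Fin 2) (g g' : Module.End ℂ (X j)) :=
      ((c g).mul_right (c' 0 a)).add_right ((c g').mul_right (c' 1 b))
    exact ((c'' _ _ _ _).mul_right (c _)).add_right ((c'' _ _ _ _).mul_right (c _))

variable [∀ i, IsSimpleModule (Uq (Complex.exp h)) (X i)]

theorem siteHom_isQTriple (hq : IsGeneric h) (hw : ∀ i, IsHighestWeight h (α i) (w i))
    (i : Fin n) :
    IsQTriple (Complex.exp h) (siteHom i (expH h (α i) (w i) (h / 2)))
      (siteHom i (expH h (α i) (w i) (-(h / 2)))) (siteHom i (act h (X i) UqGen.E))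
      (siteHom i (act h (X i) UqGen.F)) := by
  have H := isQTriple hq (hw i)
  constructor
  · rw [← map_mul, H.k_mul_k', map_one]
  · rw [← map_mul, H.k'_mul_k, map_one]
  · rw [← map_mul, H.k_mul_e, map_smul, map_mul]
  · rw [← map_mul, H.k_mul_f, map_smul, map_mul]
  · rw [← map_mul, H.e_mul_f, map_add, map_smul, map_sub, map_mul, map_mul, map_mul]

/-- The shift by h/2 in the monodromy cancels the one in the affine R-matrix. -/
theorem map_affRLeft (hq : IsGeneric h) (hw : ∀ i, IsHighestWeight h (α i) (w i)) (i : Fin n)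
    (u : ℂ) : (affRLeft h (α i) (w i) (u - h / 2 - ζ i)).map (siteOp i)
      = laxL (Complex.exp h) (siteHom i (expH h (α i) (w i) (h / 2)))
      (siteHom i (expH h (α i) (w i) (-(h / 2)))) (siteHom i (act h (X i) UqGen.E))
      (siteHom i (act h (X i) UqGen.F)) (Complex.exp (u - ζ i)) := by
  rw [affRLeft_eq hq (hw i), show u - h / 2 - ζ i + h / 2 = u - ζ i by ring]
  ext1 a b
  fin_cases a <;> fin_cases b <;> simp [laxL, ← siteHom_apply]

theorem map_affRRight (hq : IsGeneric h) (hw : ∀ i, IsHighestWeight h (α i) (w i)) (i : Fin n)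
    (u : ℂ) : (affRRight h (α i) (w i) (u - h / 2 + ζ i)).map (siteOp i)
      = laxR (Complex.exp h) (siteHom i (expH h (α i) (w i) (h / 2)))
      (siteHom i (expH h (α i) (w i) (-(h / 2)))) (siteHom i (act h (X i) UqGen.E))
      (siteHom i (act h (X i) UqGen.F)) (Complex.exp (u + ζ i)) := by
  rw [affRRight_eq hq (hw i), show u - h / 2 + ζ i + h / 2 = u + ζ i by ring]
  ext1 a b
  fin_cases a <;> fin_cases b <;> simp [laxR, ← siteHom_apply]

theorem isReflection_listMonodromy (hq : IsGeneric h)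
    (hw : ∀ i, IsHighestWeight h (α i) (w i)) (l : List (Fin n)) (hl : l.Nodup) :
    IsReflection h (listMonodromy h α ζ w l) := by
  induction l using List.reverseRecOn with
  | nil =>
    have : listMonodromy h α ζ w [] = fun _ => 1 := by ext1 u; simp [listMonodromy]
    rw [this]
    exact isReflection_one
  | append_singleton l i ih =>
    have hi : i ∉ l := fun hi => by
      simp only [List.nodup_append, List.mem_singleton] at hl
      exact hl.2.2 i hi i rfl rfl
    have c (f : Module.End ℂ (X i)) :=
      siteHom_commute_listMonodromy (h := h) (α := α) (w := w) ζ l hi f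
    have hd := (ih (List.Nodup.of_append_left hl)).dress (sub_ne_zero.mpr (hq 2 two_pos))
      (siteHom_isQTriple hq hw i) (ζ i) (c _) (c _) (c _) (c _)
    convert hd using 1
    ext1 u
    rw [listMonodromy_append, map_affRLeft ζ hq hw, map_affRRight ζ hq hw]

/-- The lower-left entry of each Lax matrix contains E and kills the vacuum, so the upper-left
eigenvalues multiply. -/
theorem isVacuum_listMonodromy (hq : IsGeneric h) (hw : ∀ i, IsHighestWeight h (α i) (w i))
    (l : List (Fin n)) (u : ℂ) :
    IsVacuum (PiTensorProduct.tprod ℂ w) (listMonodromy h α ζ w l u)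
      (l.map fun i => Complex.sinh (u - ζ i + h * ((α i - 1) / 2))
          * Complex.sinh (u + ζ i + h * ((α i - 1) / 2))).prod := by
  induction l using List.reverseRecOn with
  | nil => simp [listMonodromy, IsVacuum]
  | append_singleton l i ih =>
    have hk : siteHom i (expH h (α i) (w i) (h / 2)) (PiTensorProduct.tprod ℂ w)
        = Complex.exp (h * ((α i - 1) / 2)) • PiTensorProduct.tprod ℂ w := by
      refine siteHom_tprod i _ w ?_
      have := isExpH_expH hq (hw i) (h / 2) 0
      rw [pow_zero, Module.End.one_apply] at this
      rw [this]
      congr 2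
      push_cast
      ring
    have hk' : siteHom i (expH h (α i) (w i) (-(h / 2))) (PiTensorProduct.tprod ℂ w)
        = (Complex.exp (h * ((α i - 1) / 2)))⁻¹ • PiTensorProduct.tprod ℂ w := by
      refine siteHom_tprod i _ w ?_
      have := isExpH_expH hq (hw i) (-(h / 2)) 0
      rw [pow_zero, Module.End.one_apply] at this
      rw [this, ← Complex.exp_neg]
      congr 2
      push_cast
      ring
    have he : siteHom i (act h (X i) UqGen.E) (PiTensorProduct.tprod ℂ w) = 0 := by
      simpa using siteHom_tprod i (act h (X i) UqGen.E) w (c := 0) (by simp [(hw i).E_apply])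
    have hL : IsVacuum (PiTensorProduct.tprod ℂ w)
        ((affRLeft h (α i) (w i) (u - h / 2 - ζ i)).map (siteOp i))
        (Complex.sinh (u - ζ i + h * ((α i - 1) / 2))) := by
      rw [map_affRLeft ζ hq hw]
      constructor
      · simp only [laxL, Matrix.of_apply, Matrix.cons_val', Matrix.cons_val_zero,
          LinearMap.sub_apply, LinearMap.smul_apply, hk, hk', sinh_eq, Complex.exp_add]
        match_scalars
        ring
      · simp [laxL, he, hk']
    have hR : IsVacuum (PiTensorProduct.tprod ℂ w)
        ((affRRight h (α i) (w i) (u - h / 2 + ζ i)).map (siteOp i))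
        (Complex.sinh (u + ζ i + h * ((α i - 1) / 2))) := by
      rw [map_affRRight ζ hq hw]
      constructor
      · simp only [laxR, Matrix.of_apply, Matrix.cons_val', Matrix.cons_val_zero,
          LinearMap.sub_apply, LinearMap.smul_apply, hk, hk', sinh_eq]
        rw [Complex.exp_add (u + ζ i)]
        match_scalars
        ring
      · simp [laxR, he]
    rw [listMonodromy_append, List.map_append, List.prod_append, List.map_singleton,
      List.prod_singleton]
    convert (hL.mul ih).mul hR using 1
    ring

theorem isReflection_monodromy (hq : IsGeneric h) (hw : ∀ i, IsHighestWeight h (α i) (w i)) :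
    IsReflection h (monodromy h α ζ w) := by
  rw [funext (monodromy_eq (h := h) (α := α) (w := w) ζ)]
  exact isReflection_listMonodromy ζ hq hw _ (List.nodup_finRange n)

theorem opA_tprod (hq : IsGeneric h) (hw : ∀ i, IsHighestWeight h (α i) (w i)) (u : ℂ) :
    opA h α ζ w u (PiTensorProduct.tprod ℂ w)
      = (∏ i, Complex.sinh (u - ζ i + h * ((α i - 1) / 2))
          * Complex.sinh (u + ζ i + h * ((α i - 1) / 2))) • PiTensorProduct.tprod ℂ w := by
  rw [opA, monodromy_eq, (isVacuum_listMonodromy ζ hq hw _ u).1, ← List.ofFn_eq_map,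
    List.prod_ofFn]

theorem opDbar_eq (hq : IsGeneric h) (hw : ∀ i, IsHighestWeight h (α i) (w i)) {u : ℂ}
    (hu : Complex.sinh (2 * u - h) ≠ 0) : opDbar h α ζ w u = opA h α ζ w (-u) := by
  have := (isReflection_monodromy ζ hq hw).cross_A u
  rw [← smul_right_injective _ hu |>.eq_iff]
  change _ = Complex.sinh (2 * u - h) • monodromy h α ζ w (-u) 0 0
  rw [this]
  simp only [opDbar, opA, opD]
  match_scalars <;> field_simp

/-- Eliminating D by crossing puts the transfer matrix in a form symmetric under u ↦ -u. -/
theorem sinh_smul_transfer (hq : IsGeneric h) (hw : ∀ i, IsHighestWeight h (α i) (w i)) (u : ℂ) :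
    Complex.sinh (2 * u) • transfer h α ζ w u = Complex.sinh (2 * u + h) • opA h α ζ w u
      + Complex.sinh (2 * u - h) • opA h α ζ w (-u) := by
  have := (isReflection_monodromy ζ hq hw).cross_A u
  rw [opA, opA, this]
  simp only [transfer, opA, opD]
  have hu := Complex.exp_ne_zero u
  have hh := Complex.exp_ne_zero h
  match_scalars
  · simp only [sinh_eq, Complex.exp_add, Complex.exp_neg, exp_two_mul, neg_mul]
    field_simp
    ring
  · ring

theorem isBetheSystem (hq : IsGeneric h) (hw : ∀ i, IsHighestWeight h (α i) (w i)) :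
    IsBetheSystem h (opA h α ζ w) (opB h α ζ w) (fun u => ∏ i, Delta h (α i) (ζ i) u)
      (PiTensorProduct.tprod ℂ w) where
  comm := (isReflection_monodromy ζ hq hw).commute_B
  exchange := (isReflection_monodromy ζ hq hw).exchange
  cross := (isReflection_monodromy ζ hq hw).cross_B
  vacuum u := by
    rw [opA_tprod ζ hq hw]
    congr 1
    refine Finset.prod_congr rfl fun i _ => ?_
    rw [Delta]
    congr 2 <;> ring

end Chain

/-! ### Bethe equations and eigenvalue in terms of exchange factors. -/

section Equations

variable (h : ℂ) {n M : ℕ} (α ζ : Fin n → ℂ) (v : Fin M → ℂ)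

theorem exchangeFactor_neg (x w : ℂ) : exchangeFactor h (-x) w
    = (Complex.sinh (x - w + h) * Complex.sinh (x + w + h))
      / (Complex.sinh (x - w) * Complex.sinh (x + w)) := by
  rw [exchangeFactor, show -x - w - h = -(x + w + h) by ring,
    show -x + w - h = -(x - w + h) by ring, show -x - w = -(x + w) by ring,
    show -x + w = -(x - w) by ring]
  simp only [Complex.sinh_neg, neg_mul_neg]
  rw [mul_comm, mul_comm (Complex.sinh (x + w))]

/-- The weights at v_m and -v_m have the same denominator, nonzero by admissibility, so equality of
weights is equality of numerators. -/
theorem clearedBetheEquations_iff (hv : IsAdmissible v) :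
    ClearedBetheEquations h α ζ v ↔ ∀ m,
      betheWeight h (fun u => ∏ i, Delta h (α i) (ζ i) u) v m (v m)
        = betheWeight h (fun u => ∏ i, Delta h (α i) (ζ i) u) v m (-v m) := by
  refine forall_congr' fun m => ?_
  have hD : ∏ k ∈ Finset.univ.erase m,
      Complex.sinh (v m - v k) * Complex.sinh (v m + v k) ≠ 0 :=
    Finset.prod_ne_zero_iff.mpr fun k hk =>
      mul_ne_zero (hv.2 m k (Finset.ne_of_mem_erase hk)).1 (hv.2 m k (Finset.ne_of_mem_erase hk)).2
  simp only [betheWeight, exchangeFactor_neg]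
  simp only [exchangeFactor, Finset.prod_div_distrib, ← mul_div_assoc]
  rw [div_left_inj' hD]

theorem betheEquations_iff (hd : DenominatorsNeZero h α ζ v) :
    BetheEquations h α ζ v ↔ ClearedBetheEquations h α ζ v := by
  refine forall_congr' fun m => ?_
  have h1 : ∏ i, Delta h (α i) (ζ i) (-v m) ≠ 0 :=
    Finset.prod_ne_zero_iff.mpr fun i _ => (hd m).1 i
  have h2 : ∏ k ∈ Finset.univ.erase m,
      Complex.sinh (v m - v k - h) * Complex.sinh (v m + v k - h) ≠ 0 :=
    Finset.prod_ne_zero_iff.mpr fun k hk =>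
      mul_ne_zero ((hd m).2 k (Finset.ne_of_mem_erase hk)).1
        ((hd m).2 k (Finset.ne_of_mem_erase hk)).2
  rw [Finset.prod_div_distrib, Finset.prod_div_distrib, div_eq_div_iff h1 h2]
  constructor <;> intro e <;> rw [e] <;> ring

theorem Lambda_eq (u : ℂ) : Lambda h α ζ v u
    = Complex.sinh (2 * u + h) / Complex.sinh (2 * u) * (∏ i, Delta h (α i) (ζ i) u)
        * ∏ m, exchangeFactor h u (v m)
      + Complex.sinh (2 * u - h) / Complex.sinh (2 * u) * (∏ i, Delta h (α i) (ζ i) (-u))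
        * ∏ m, exchangeFactor h (-u) (v m) := by
  simp only [exchangeFactor_neg, Lambda]
  simp only [exchangeFactor]

end Equations

end QChain

/-! ### The main theorem. -/

theorem mainTheorem6 (h : ℂ) (hq : IsGeneric h) (n : ℕ) (α ζ : Fin n → ℂ) (X : Fin n → Type*)
    [∀ i, AddCommGroup (X i)] [∀ i, Module ℂ (X i)] [∀ i, Module (Uq (Complex.exp h)) (X i)]
    [∀ i, IsScalarTower ℂ (Uq (Complex.exp h)) (X i)]
    [∀ i, IsSimpleModule (Uq (Complex.exp h)) (X i)]
    (w : ∀ i, X i) (hw : ∀ i, IsHighestWeight h (α i) (w i)) :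
    (∀ u : ℂ, opA h α ζ w u (PiTensorProduct.tprod ℂ w)
      = (∏ i, Complex.sinh (u - ζ i + h * ((α i - 1) / 2))
          * Complex.sinh (u + ζ i + h * ((α i - 1) / 2))) • PiTensorProduct.tprod ℂ w) ∧
    (∀ u : ℂ, Complex.sinh (2 * u - h) ≠ 0 →
      opDbar h α ζ w u (PiTensorProduct.tprod ℂ w)
        = (∏ i, Complex.sinh (u - ζ i - h * ((α i - 1) / 2))
            * Complex.sinh (u + ζ i - h * ((α i - 1) / 2))) • PiTensorProduct.tprod ℂ w) ∧
    ∀ (M : ℕ) (v : Fin M → ℂ), IsAdmissible v →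
      (ClearedBetheEquations h α ζ v →
        ∀ u : ℂ, IsRegularPoint v u →
          transfer h α ζ w u (betheVector h α ζ w v)
            = Lambda h α ζ v u • betheVector h α ζ w v) ∧
      ((∀ u : ℂ, IsRegularPoint v u →
          (transfer h α ζ w u).HasEigenvector (Lambda h α ζ v u) (betheVector h α ζ w v)) ↔
        betheVector h α ζ w v ≠ 0 ∧ ClearedBetheEquations h α ζ v) ∧
      (DenominatorsNeZero h α ζ v →
        ((∀ u : ℂ, IsRegularPoint v u →
            (transfer h α ζ w u).HasEigenvector (Lambda h α ζ v u) (betheVector h α ζ w v)) ↔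
          betheVector h α ζ w v ≠ 0 ∧ BetheEquations h α ζ v)) := by
  have hS := isBetheSystem ζ hq hw
  refine ⟨opA_tprod ζ hq hw, fun u hu => ?_, fun M v hv => ?_⟩
  · rw [opDbar_eq ζ hq hw hu, opA_tprod ζ hq hw]
    congr 1
    refine Finset.prod_congr rfl fun i _ => ?_
    rw [show -u - ζ i + h * ((α i - 1) / 2) = -(u + ζ i - h * ((α i - 1) / 2)) by ring,
      show -u + ζ i + h * ((α i - 1) / 2) = -(u - ζ i - h * ((α i - 1) / 2)) by ring,
      Complex.sinh_neg, Complex.sinh_neg, neg_mul_neg, mul_comm]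
  have offShell (u : ℂ) (hu : IsRegularPoint v u) :=
    hS.transfer_creation v hv hu (sinh_smul_transfer ζ hq hw u)
  simp only [← Lambda_eq] at offShell
  change ∀ u, _ → transfer h α ζ w u (betheVector h α ζ w v) = _ • betheVector h α ζ w v + _
    at offShell
  have onShell (hc : ClearedBetheEquations h α ζ v) (u : ℂ) (hu : IsRegularPoint v u) :
      transfer h α ζ w u (betheVector h α ζ w v)
        = Lambda h α ζ v u • betheVector h α ζ w v := by
    rw [offShell u hu, Finset.sum_eq_zero, add_zero]
    intro m _
    rw [(clearedBetheEquations_iff h α ζ v hv).mp hc m, sub_self, mul_zero, zero_div, zero_smul]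
  have key : (∀ u : ℂ, IsRegularPoint v u →
      (transfer h α ζ w u).HasEigenvector (Lambda h α ζ v u) (betheVector h α ζ w v)) ↔
      betheVector h α ζ w v ≠ 0 ∧ ClearedBetheEquations h α ζ v := by
    refine ⟨fun he => ?_, fun ⟨h0, hc⟩ u hu =>
      ⟨Module.End.mem_eigenspace_iff.mpr (onShell hc u hu), h0⟩⟩
    -- A regular point has to exist, since the hypothesis gives nonvanishing of the Bethe vector
    -- only at such points.
    obtain ⟨u, hu⟩ := (eventually_isRegularPoint v 0).exists
    have h0 := (he u hu).2
    refine ⟨h0, (clearedBetheEquations_iff h α ζ v hv).mpr fun m => ?_⟩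
    refine hS.betheWeight_eq (by simpa using hq.sinh_ne_zero one_pos)
      (by simpa using hq.sinh_ne_zero two_pos)
      (fun x φ => ((isReflection_monodromy ζ hq hw).cont 0 1).continuous
        (φ ∘ₗ LinearMap.applyₗ x)) v hv h0 (fun u hu => ?_) m
    have e := offShell u hu
    -- Comparing the eigenvalue equation with the off-shell formula leaves the sum of unwanted terms
    -- equal to zero.
    rw [Module.End.mem_eigenspace_iff.mp (he u hu).1] at e
    exact left_eq_add.mp e
  exact ⟨onShell, key, fun hd => by rw [key, betheEquations_iff h α ζ v hd]⟩
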